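/- Let $\mathsf A$ be a Grothendieck category and let $\mathsf C$ be a full additive subcategory of $\mathsf A$, closed under isomorphisms and direct summands, which is special preenveloping: every object $M$ admits a special $\mathsf C$-preenvelope, i.e. an exact sequence $0\to M\to I\to \Sigma\to 0$ with $I\in\mathsf C$ and $\Sigma\in{}^{\perp}\mathsf C=\{X \mid \operatorname{Ext}^1_{\mathsf A}(X,C)=0 \text{ for all } C\in\mathsf C\}$. A special proper $\mathsf C$-coresolution of $M$ is a complex $I^0\to I^1\to\cdots$ obtained by splicing special $\mathsf C$-preenvelopes $0\to \Sigma^iM\to I^i\to\Sigma^{i+1}M\to 0$ $(i\ge 0)$, with $\Sigma^0M=M$; the object $\Sigma^iM=\operatorname{Ker}(I^i\to I^{i+1})$ is the $i$-th $\mathsf C$-cosyzygy of $M$. Let $\underline{\operatorname{Hom}}^{\mathsf C}_{\mathsf A}(M,N)$ be the value at $M$ of the $\mathsf C$-stable functor of $F=\operatorname{Hom}_{\mathsf A}(-,N)$, that is, the cokernel of the natural map $\rho\colon \mathrm L_0^{\mathsf C}F(M)=\operatorname{Coker}(F(I^1)\to F(I^0))\to F(M)$ (it equals the quotient of $\operatorname{Hom}_{\mathsf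 A}(M,N)$ by the morphisms that factor through an object of $\mathsf C$). For a contravariant additive functor $F$ put $\mathsf S^{-1}_{\mathsf C}F(M)=\operatorname{Ker}(F(\Sigma)\to F(I))$ for a special $\mathsf C$-preenvelope $0\to M\to I\to\Sigma\to0$, and $\mathsf S^{0}_{\mathsf C}F=F$, $\mathsf S^{-k}_{\mathsf C}F=\mathsf S^{-1}_{\mathsf C}(\mathsf S^{-k+1}_{\mathsf C}F)$; write $\mathsf S^{-k}_{\mathsf C}\operatorname{Ext}^m_{\mathsf A}(M,N)$ for $\mathsf S^{-k}_{\mathsf C}F(M)$ with $F=\operatorname{Ext}^m_{\mathsf A}(-,N)$. Fix special proper $\mathsf C$-coresolutions of $M$ and $N$. The connecting maps $\delta\colon\operatorname{Hom}(\Sigma^jM,\Sigma^kN)\to\operatorname{Ext}^1(\Sigma^{j+1}M,\Sigma^kN)$ and $\partial\colon\operatorname{Hom}(\Sigma^{j+1}M,\Sigma^{k+1}N)\to\operatorname{Ext}^1(\Sigma^{j+1}M,\Sigma^kN)$ induce maps $$\underline{\operatorname{Hom}}^{\mathsf C}_{\mathsf A}(\Sigma^jM,\Sigma^kN)\xrightarrow{\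 \bar\delta\ }\operatorname{Ext}^1_{\mathsf A}(\Sigma^{j+1}M,\Sigma^kN)\xrightarrow{\ \beta\ }\underline{\operatorname{Hom}}^{\mathsf C}_{\mathsf A}(\Sigma^{j+1}M,\Sigma^{k+1}N),$$ where $\bar\delta$ is induced by $\delta$, and $\beta\partial$ is the canonical projection. Moreover $\bar\delta\beta=\iota\mu$, where $\iota\colon\mathsf S^{-1}_{\mathsf C}\operatorname{Ext}^1(\Sigma^{j+1}M,\Sigma^{k+1}N)\hookrightarrow\operatorname{Ext}^1(\Sigma^{j+2}M,\Sigma^{k+1}N)$ is the inclusion and $\mu\colon \operatorname{Ext}^1(\Sigma^{j+1}M,\Sigma^kN)\to\mathsf S^{-1}_{\mathsf C}\operatorname{Ext}^1(\Sigma^{j+1}M,\Sigma^{k+1}N)$. For $n\in\mathbb Z$ the complete cohomology is $$\widetilde{\operatorname{Ext}}{}^{\,n}_{\mathsf C}(M,N)=\operatorname{colim}_i\,\underline{\operatorname{Hom}}^{\mathsf C}_{\mathsf A}(\Sigma^iM,\Sigma^{i+n}N)\qquad(i\ge0,\ i+n\ge0)$$ with transition maps $\beta\bar\delta$. Theorem.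 For every $n\in\mathbb Z$ there are isomorphisms, natural in $M$ and $N$ (that is, compatible with all morphisms of special proper $\mathsf C$-coresolutions lifting morphisms in $\mathsf A$, in both variables), $$\widetilde{\operatorname{Ext}}{}^{\,n}_{\mathsf C}(M,N)\;\cong\;\operatorname{colim}_i\operatorname{Ext}^1_{\mathsf A}(\Sigma^{i+1}M,\Sigma^{i+n}N)\;\cong\;\operatorname{colim}_i\mathsf S^{-1}_{\mathsf C}\operatorname{Ext}^1_{\mathsf A}(\Sigma^{i}M,\Sigma^{i+n}N),$$ where the transition maps are $\bar\delta\beta$ and $\mu\iota$, respectively. If moreover $\mathsf C$ is coresolving (it contains all injectives and, for every exact sequence $0\to X'\to X\to X''\to0$ with $X'\in\mathsf C$, one has $X\in\mathsf C$ if and only if $X''\in\mathsf C$), then there is also an isomorphism, natural in $M$ and $N$, $$\widetilde{\operatorname{Ext}}{}^{\,n}_{\mathsf C}(M,N)\;\cong\;\operatorname{colim}_i\mathsf S^{-i}_{\mathsf C}\operatorname{Ext}^{n+i}_{\mathsf A}(M,N)\qquad(i\ge0,\ i+n\ge0),$$ where the transition maps are induced by the connecting maps $\operatorname{Ext}^{m}_{\mathsf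 A}(M,N)\to\operatorname{Ext}^{m+1}_{\mathsf A}(\Sigma,N)$ of special $\mathsf C$-preenvelopes $0\to M\to I\to\Sigma\to0$. -/

import Mathlib

open CategoryTheory Category Limits Opposite Abelian

universe v u v' u' w'

noncomputable section

namespace CComplete

section Basic

variable {A : Type u} [Category.{v} A] [Abelian A]

/-- The bifunctor `(X, Y) ↦ Hom(X, Y)` with values in abelian groups. -/
@[simps]
def homFunctor : Aᵒᵖ ⥤ A ⥤ AddCommGrpCat.{v} where
  obj X :=
    { obj := fun Y => AddCommGrpCat.of (X.unop ⟶ Y)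
      map := fun g => AddCommGrpCat.ofHom (AddMonoidHom.mk' (fun f => f ≫ g) (by simp)) }
  map h :=
    { app := fun Y => AddCommGrpCat.ofHom (AddMonoidHom.mk' (fun f => h.unop ≫ f) (by simp)) }

instance : (homFunctor (A := A)).Additive where

/-- `C` is coresolving: it contains all injectives and, for every short exact sequence
`0 → X' → X → X'' → 0` with `X'` in `C`, one has `X ∈ C` if and only if `X'' ∈ C`. -/
structure IsCoresolving (C : ObjectProperty A) : Prop where
  injective_mem : ∀ X : A, Injective X → C X
  mem_iff : ∀ S : ShortComplex A, S.ShortExact → C S.X₁ → (C S.X₂ ↔ C S.X₃)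

end Basic

variable {A : Type u} [Category.{v} A] [Abelian A] [HasExt.{v} A]

/-- The class `⊥C` of all objects `M` with `Ext¹(M, X) = 0` for all `X` in `C`. -/
def leftPerp (C : ObjectProperty A) : ObjectProperty A :=
  fun M => ∀ X : A, C X → Subsingleton (Ext.{v} M X 1)

/-- A short complex `0 → M → I → S → 0` is a special `C`-preenvelope (of `M`) if it is exact,
`I` is in `C` and `S` is in `⊥C`. -/
def isSpecialPreenvelope (C : ObjectProperty A) : ObjectProperty (ShortComplex A) :=
  fun S => S.ShortExact ∧ C S.X₂ ∧ leftPerp C S.X₃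

/-- The category of all special `C`-preenvelopes; its morphisms are the morphisms of
short exact sequences. -/
abbrev SpecialPreenvelope (C : ObjectProperty A) := (isSpecialPreenvelope C).FullSubcategory

/-- Every object of the category has a special `C`-preenvelope. -/
def IsSpecialPreenveloping (C : ObjectProperty A) : Prop :=
  ∀ M : A, ∃ (I S : A) (i : M ⟶ I) (p : I ⟶ S) (w : i ≫ p = 0),
    isSpecialPreenvelope C (ShortComplex.mk i p w)

variable {C : ObjectProperty A}

namespace SpecialPreenvelope

theorem shortExact (E : SpecialPreenvelope C) : E.obj.ShortExact := E.property.1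

theorem mem (E : SpecialPreenvelope C) : C E.obj.X₂ := E.property.2.1

theorem perp (E : SpecialPreenvelope C) : leftPerp C E.obj.X₃ := E.property.2.2

/-- The map `Hom(M, Y) → Ext¹(S, Y)` given by `f ↦ e · f`, for `e` the class of
`0 → M → I → S → 0`. -/
def conn₀ (E : SpecialPreenvelope C) (Y : A) : (E.obj.X₁ ⟶ Y) →+ Ext.{v} E.obj.X₃ Y 1 :=
  AddMonoidHom.mk' (fun f => E.shortExact.extClass.comp (Ext.mk₀ f) (add_zero 1))
    (fun a b => by rw [Ext.mk₀_add, Ext.comp_add])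

theorem conn₀_apply (E : SpecialPreenvelope C) {Y : A} (f : E.obj.X₁ ⟶ Y) :
    E.conn₀ Y f = E.shortExact.extClass.comp (Ext.mk₀ f) (add_zero 1) := rfl

/-- Morphisms from `M` to objects of `C` extend along a special preenvelope `M → I`. -/
theorem exists_extension (E : SpecialPreenvelope C) {X : A} (hX : C X) (f : E.obj.X₁ ⟶ X) :
    ∃ g : E.obj.X₂ ⟶ X, E.obj.f ≫ g = f := by
  have h0 : E.shortExact.extClass.comp (Ext.mk₀ f) (add_zero 1) = 0 :=
    @Subsingleton.elim _ (E.perp X hX) _ _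
  obtain ⟨x, hx⟩ := Ext.contravariant_sequence_exact₁ E.shortExact X (Ext.mk₀ f) (add_zero 1) h0
  obtain ⟨g, rfl⟩ := Ext.mk₀_addEquiv₀_apply x ▸ (⟨Ext.addEquiv₀ x, rfl⟩ :
    ∃ g, Ext.mk₀ g = Ext.mk₀ (Ext.addEquiv₀ x))
  refine ⟨g, ?_⟩
  rw [Ext.mk₀_comp_mk₀] at hx
  exact (Ext.mk₀_bijective _ _).1 hx

/-- Every morphism lifts to a morphism of special preenvelopes. -/
theorem exists_lift (E E' : SpecialPreenvelope C) (f : E.obj.X₁ ⟶ E'.obj.X₁) :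
    ∃ φ : E ⟶ E', φ.hom.τ₁ = f := by
  obtain ⟨g, hg⟩ := E.exists_extension E'.mem (f ≫ E'.obj.f)
  have := E.shortExact.epi_g
  have hz : E.obj.f ≫ g ≫ E'.obj.g = 0 := by
    rw [← assoc, hg, assoc, E'.obj.zero, comp_zero]
  exact ⟨ObjectProperty.homMk
    { τ₁ := f, τ₂ := g, τ₃ := E.shortExact.exact.desc (g ≫ E'.obj.g) hz
      comm₁₂ := hg.symm
      comm₂₃ := by simp }, rfl⟩

/-- The map `Hom(X, S) → Ext¹(X, M)` given by `g ↦ g · e`, for `e` the class of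
`0 → M → I → S → 0`. -/
def coconn₀ (E : SpecialPreenvelope C) (X : A) : (X ⟶ E.obj.X₃) →+ Ext.{v} X E.obj.X₁ 1 :=
  AddMonoidHom.mk' (fun g => (Ext.mk₀ g).comp E.shortExact.extClass (zero_add 1))
    (fun a b => by rw [Ext.mk₀_add, Ext.add_comp])

theorem coconn₀_apply (E : SpecialPreenvelope C) {X : A} (g : X ⟶ E.obj.X₃) :
    E.coconn₀ X g = (Ext.mk₀ g).comp E.shortExact.extClass (zero_add 1) := rfl

variable (C)

/-- `(0 → M → I → S → 0) ↦ M`. -/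
def source : SpecialPreenvelope C ⥤ A := (isSpecialPreenvelope C).ι ⋙ ShortComplex.π₁

/-- `(0 → M → I → S → 0) ↦ S`. -/
def quotient : SpecialPreenvelope C ⥤ A := (isSpecialPreenvelope C).ι ⋙ ShortComplex.π₃

/-- The connecting maps `Hom(M, Y) → Ext¹(S, Y)`, as a natural transformation. -/
def connHom : (source C).op ⋙ homFunctor ⟶ (quotient C).op ⋙ extFunctor.{v} 1 where
  app E :=
    { app := fun Y => AddCommGrpCat.ofHom (E.unop.conn₀ Y)
      naturality := by
        intro Y Y' g
        ext (f : E.unop.obj.X₁ ⟶ Y)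
        change E.unop.shortExact.extClass.comp (Ext.mk₀ (f ≫ g)) (add_zero 1) =
          (E.unop.shortExact.extClass.comp (Ext.mk₀ f) (add_zero 1)).comp
            (Ext.mk₀ g) (add_zero 1)
        rw [Ext.comp_assoc_of_third_deg_zero, Ext.mk₀_comp_mk₀] }
  naturality := by
    intro E E' φ
    ext Y (f : E.unop.obj.X₁ ⟶ Y)
    change E'.unop.shortExact.extClass.comp (Ext.mk₀ (φ.unop.hom.τ₁ ≫ f)) (add_zero 1) =
      (Ext.mk₀ φ.unop.hom.τ₃).comp
        (E.unop.shortExact.extClass.comp (Ext.mk₀ f) (add_zero 1)) (zero_add 1)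
    rw [← Ext.comp_assoc_of_third_deg_zero,
      ← ShortComplex.ShortExact.extClass_naturality E'.unop.shortExact E.unop.shortExact,
      Ext.comp_assoc_of_third_deg_zero, Ext.mk₀_comp_mk₀]

/-- The connecting maps `Extᵐ(M, Y) → Extᵐ⁺¹(S, Y)`, `x ↦ e · x`, as a natural
transformation. -/
def connExt (m : ℕ) :
    (source C).op ⋙ extFunctor.{v} m ⟶ (quotient C).op ⋙ extFunctor.{v} (m + 1) where
  app E :=
    { app := fun Y => AddCommGrpCat.ofHom (E.unop.shortExact.extClass.precomp Y (add_comm 1 m))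
      naturality := by
        intro Y Y' g
        ext (f : Ext.{v} E.unop.obj.X₁ Y m)
        change E.unop.shortExact.extClass.comp (f.comp (Ext.mk₀ g) (add_zero m)) (add_comm 1 m) =
          (E.unop.shortExact.extClass.comp f (add_comm 1 m)).comp (Ext.mk₀ g) (add_zero (m + 1))
        rw [Ext.comp_assoc_of_third_deg_zero] }
  naturality := by
    intro E E' φ
    ext Y (f : Ext.{v} E.unop.obj.X₁ Y m)
    change E'.unop.shortExact.extClass.comp
        ((Ext.mk₀ φ.unop.hom.τ₁).comp f (zero_add m)) (add_comm 1 m) =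
      (Ext.mk₀ φ.unop.hom.τ₃).comp
        (E.unop.shortExact.extClass.comp f (add_comm 1 m)) (zero_add (m + 1))
    rw [← Ext.comp_assoc (a₁₂ := 1) (a₂₃ := m) _ _ _ (by lia) (by lia) (by lia),
      ← Ext.comp_assoc (a₁₂ := 1) (a₂₃ := m + 1) _ _ _ (by lia) (by lia) (by lia),
      ← ShortComplex.ShortExact.extClass_naturality E'.unop.shortExact E.unop.shortExact]

/-- The connecting maps `Hom(X, S) → Ext¹(X, M)`, as a natural transformation. -/
def coconnHom : homFunctor ⋙ (Functor.whiskeringLeft _ _ _).obj (quotient C) ⟶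
    extFunctor.{v} 1 ⋙ (Functor.whiskeringLeft _ _ _).obj (source C) where
  app X :=
    { app := fun E => AddCommGrpCat.ofHom (E.coconn₀ X.unop)
      naturality := by
        intro E E' φ
        ext (g : X.unop ⟶ E.obj.X₃)
        change (Ext.mk₀ (g ≫ φ.hom.τ₃)).comp E'.shortExact.extClass (zero_add 1) =
          ((Ext.mk₀ g).comp E.shortExact.extClass (zero_add 1)).comp
            (Ext.mk₀ φ.hom.τ₁) (add_zero 1)
        rw [Ext.comp_assoc_of_third_deg_zero,
          ShortComplex.ShortExact.extClass_naturality E.shortExact E'.shortExact,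
          ← Ext.mk₀_comp_mk₀]
        exact Ext.comp_assoc (Ext.mk₀ g) (Ext.mk₀ φ.hom.τ₃) _ (zero_add 0) (zero_add 1) (by lia) }
  naturality X X' h := by
    ext E (g : X.unop ⟶ E.obj.X₃)
    change (Ext.mk₀ (h.unop ≫ g)).comp E.shortExact.extClass (zero_add 1) =
      (Ext.mk₀ h.unop).comp ((Ext.mk₀ g).comp E.shortExact.extClass (zero_add 1)) (zero_add 1)
    rw [← Ext.mk₀_comp_mk₀]
    exact Ext.comp_assoc (Ext.mk₀ h.unop) (Ext.mk₀ g) _ (zero_add 0) (zero_add 1) (by lia)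

end SpecialPreenvelope

/-! ### Left satellites of contravariant functors -/

section Satellite

open SpecialPreenvelope

variable {D : Type u'} [Category.{v'} D] [Abelian D]

/-- The left satellite of `F` computed on special `C`-preenvelopes:
`(0 → M → I → S → 0) ↦ Ker (F(S) → F(I))`. -/
def satelliteOn (C : ObjectProperty A) (F : Aᵒᵖ ⥤ D) : (SpecialPreenvelope C)ᵒᵖ ⥤ D where
  obj E := kernel (F.map E.unop.obj.g.op)
  map {E E'} φ := kernel.map (F.map E.unop.obj.g.op) (F.map E'.unop.obj.g.op)
    (F.map φ.unop.hom.τ₃.op) (F.map φ.unop.hom.τ₂.op) (by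
      rw [← F.map_comp, ← F.map_comp, ← op_comp, ← op_comp, φ.unop.hom.comm₂₃])
  map_id E := by
    rw [← cancel_mono (kernel.ι _)]
    simp
  map_comp φ ψ := by
    rw [← cancel_mono (kernel.ι _)]
    simp

/-- The inclusion `Ker (F(S) → F(I)) → F(S)`. -/
def satelliteOnι (F : Aᵒᵖ ⥤ D) (E : SpecialPreenvelope C) :
    (satelliteOn C F).obj (op E) ⟶ F.obj (op E.obj.X₃) :=
  kernel.ι (F.map E.obj.g.op)

instance (F : Aᵒᵖ ⥤ D) (E : SpecialPreenvelope C) : Mono (satelliteOnι F E) :=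
  inferInstanceAs (Mono (kernel.ι (F.map E.obj.g.op)))

theorem satelliteOnι_naturality (F : Aᵒᵖ ⥤ D) {E E' : SpecialPreenvelope C} (φ : E ⟶ E') :
    (satelliteOn C F).map φ.op ≫ satelliteOnι F E =
      satelliteOnι F E' ≫ F.map φ.hom.τ₃.op :=
  kernel.lift_ι _ _ _

theorem satelliteOnι_naturality_assoc (F : Aᵒᵖ ⥤ D) {E E' : SpecialPreenvelope C} (φ : E ⟶ E')
    {X : D} (h : F.obj (op E.obj.X₃) ⟶ X) :
    (satelliteOn C F).map φ.op ≫ satelliteOnι F E ≫ h =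
      satelliteOnι F E' ≫ F.map φ.hom.τ₃.op ≫ h := by
  rw [← assoc, satelliteOnι_naturality, assoc]

theorem satelliteOnι_comp (F : Aᵒᵖ ⥤ D) (E : SpecialPreenvelope C) :
    satelliteOnι F E ≫ F.map E.obj.g.op = 0 :=
  kernel.condition _

theorem satelliteOnι_comp_assoc (F : Aᵒᵖ ⥤ D) (E : SpecialPreenvelope C)
    {X : D} (h : F.obj (op E.obj.X₂) ⟶ X) :
    satelliteOnι F E ≫ F.map E.obj.g.op ≫ h = 0 ≫ h := by
  rw [← assoc, satelliteOnι_comp]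

/-- Morphisms to `F(S)` with zero composite to `F(I)` factor through the satellite. -/
def satelliteOnLift {F : Aᵒᵖ ⥤ D} {E : SpecialPreenvelope C} {X : D} (k : X ⟶ F.obj (op E.obj.X₃))
    (hk : k ≫ F.map E.obj.g.op = 0) : X ⟶ (satelliteOn C F).obj (op E) :=
  kernel.lift (F.map E.obj.g.op) k hk

theorem satelliteOnLift_ι {F : Aᵒᵖ ⥤ D} {E : SpecialPreenvelope C} {X : D}
    (k : X ⟶ F.obj (op E.obj.X₃)) (hk : k ≫ F.map E.obj.g.op = 0) :
    satelliteOnLift k hk ≫ satelliteOnι F E = k :=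
  kernel.lift_ι _ _ _

theorem satelliteOnLift_ι_assoc {F : Aᵒᵖ ⥤ D} {E : SpecialPreenvelope C} {X : D}
    (k : X ⟶ F.obj (op E.obj.X₃)) (hk : k ≫ F.map E.obj.g.op = 0)
    {Y : D} (h : F.obj (op E.obj.X₃) ⟶ Y) :
    satelliteOnLift k hk ≫ satelliteOnι F E ≫ h = k ≫ h := by
  rw [← assoc, satelliteOnLift_ι]

theorem satelliteOn_map_eq (F : Aᵒᵖ ⥤ D) [F.Additive] {E E' : SpecialPreenvelope C}
    (φ ψ : E ⟶ E') (h : φ.hom.τ₁ = ψ.hom.τ₁) :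
    (satelliteOn C F).map φ.op = (satelliteOn C F).map ψ.op := by
  have := E.shortExact.epi_g
  have := E'.shortExact.mono_f
  let α := φ.hom - ψ.hom
  have hα : α.τ₁ = 0 := by simp [α, h]
  have hz : E.obj.f ≫ α.τ₂ = 0 := by rw [← α.comm₁₂, hα, zero_comp]
  have h3 : α.τ₃ = E.shortExact.exact.desc α.τ₂ hz ≫ E'.obj.g := by
    rw [← cancel_epi E.obj.g, ShortComplex.Exact.g_desc_assoc, α.comm₂₃]
  have h4 : satelliteOnι F E' ≫ F.map α.τ₃.op = 0 := by
    rw [h3, op_comp, F.map_comp, satelliteOnι_comp_assoc, zero_comp]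
  rw [← cancel_mono (satelliteOnι F E), satelliteOnι_naturality, satelliteOnι_naturality]
  rw [ShortComplex.sub_τ₃, op_sub, F.map_sub, Preadditive.comp_sub, sub_eq_zero] at h4
  exact h4

variable (hC : IsSpecialPreenveloping C)

/-- A chosen special `C`-preenvelope of `M`. -/
def chosen (M : A) : SpecialPreenvelope C :=
  ⟨ShortComplex.mk (X₁ := M) (hC M).choose_spec.choose_spec.choose
    (hC M).choose_spec.choose_spec.choose_spec.choose
    (hC M).choose_spec.choose_spec.choose_spec.choose_spec.choose,
    (hC M).choose_spec.choose_spec.choose_spec.choose_spec.choose_spec⟩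

/-- A chosen lift of `f : M → M'` to the chosen special preenvelopes. -/
def chosenMap {M M' : A} (f : M ⟶ M') : chosen hC M ⟶ chosen hC M' :=
  (exists_lift (chosen hC M) (chosen hC M') f).choose

theorem chosenMap_τ₁ {M M' : A} (f : M ⟶ M') : (chosenMap hC f).hom.τ₁ = f :=
  (exists_lift (chosen hC M) (chosen hC M') f).choose_spec

/-- The left satellite `S⁻¹ F` of a contravariant additive functor `F` with respect to `C`:
`S⁻¹ F (M) = Ker (F(S) → F(I))` for a special `C`-preenvelope `0 → M → I → S → 0`. -/
def satellite (F : Aᵒᵖ ⥤ D) [F.Additive] : Aᵒᵖ ⥤ D where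
  obj M := (satelliteOn C F).obj (op (chosen hC M.unop))
  map f := (satelliteOn C F).map (chosenMap hC f.unop).op
  map_id M := by
    rw [← (satelliteOn C F).map_id]
    exact satelliteOn_map_eq F _ (𝟙 _) (chosenMap_τ₁ hC _)
  map_comp f g := by
    rw [← (satelliteOn C F).map_comp, ← op_comp]
    apply satelliteOn_map_eq
    simp only [chosenMap_τ₁, ObjectProperty.FullSubcategory.comp_hom, ShortComplex.comp_τ₁]
    rfl

instance (F : Aᵒᵖ ⥤ D) [F.Additive] : (satellite hC F).Additive where
  map_add {M M' f g} := by
    let ψ : chosen hC M'.unop ⟶ chosen hC M.unop :=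
      ObjectProperty.homMk ((chosenMap hC f.unop).hom + (chosenMap hC g.unop).hom)
    have hψ : ψ.hom.τ₁ = f.unop + g.unop :=
      congr_arg₂ (· + ·) (chosenMap_τ₁ hC f.unop) (chosenMap_τ₁ hC g.unop)
    have h : (satelliteOn C F).map (chosenMap hC (f + g).unop).op =
        (satelliteOn C F).map ψ.op :=
      satelliteOn_map_eq F _ _ ((chosenMap_τ₁ hC _).trans hψ.symm)
    refine h.trans ?_
    change _ = (satelliteOn C F).map (chosenMap hC f.unop).op +
      (satelliteOn C F).map (chosenMap hC g.unop).op
    rw [← cancel_mono (satelliteOnι F _), Preadditive.add_comp, satelliteOnι_naturality,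
      satelliteOnι_naturality, satelliteOnι_naturality, ← Preadditive.comp_add, ← F.map_add]
    rfl

/-- `S⁻¹` on natural transformations. -/
def satelliteMap {F G : Aᵒᵖ ⥤ D} [F.Additive] [G.Additive] (α : F ⟶ G) :
    satellite hC F ⟶ satellite hC G where
  app M := satelliteOnLift (X := (satelliteOn C F).obj (op (chosen hC M.unop)))
    (satelliteOnι F (chosen hC M.unop) ≫ α.app _) (by
      rw [assoc, ← α.naturality, satelliteOnι_comp_assoc, zero_comp])
  naturality M M' f := by
    change (satelliteOn C F).map (chosenMap hC f.unop).op ≫ _ =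
      _ ≫ (satelliteOn C G).map (chosenMap hC f.unop).op
    apply (cancel_mono (satelliteOnι G _)).1
    simp only [assoc, satelliteOnLift_ι, satelliteOnι_naturality, satelliteOnLift_ι_assoc,
      satelliteOnι_naturality_assoc, α.naturality]

/-- The iterated satellites: `S⁰ F = F` and `S⁻ᵏ⁻¹ F = S⁻¹ (S⁻ᵏ F)`. -/
def iteratedSatellite : ℕ → (Aᵒᵖ ⥤+ D) → (Aᵒᵖ ⥤+ D)
  | 0, F => F
  | k + 1, F => AdditiveFunctor.of (satellite hC (iteratedSatellite k F).obj)

/-- `Extᵐ` as an additive functor in the first variable (with values in functors of the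
second variable). -/
def extAdd (m : ℕ) : Aᵒᵖ ⥤+ (A ⥤ AddCommGrpCat.{v}) := AdditiveFunctor.of (extFunctor.{v} m)

/-- The connecting map `Extᵐ(M, -) → Extᵐ⁺¹(S, -)` of the chosen special preenvelope of `M`. -/
def connChosen (m : ℕ) (M : Aᵒᵖ) :
    (extFunctor.{v} m).obj M ⟶ (extFunctor.{v} (m + 1)).obj (op (chosen hC M.unop).obj.X₃) :=
  (connExt C m).app (op (chosen hC M.unop))

theorem connChosen_comp (m : ℕ) (M : Aᵒᵖ) :
    connChosen hC m M ≫ (extFunctor.{v} (m + 1)).map (chosen hC M.unop).obj.g.op = 0 := by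
  ext Y (x : Ext.{v} (chosen hC M.unop).obj.X₁ Y m)
  exact (chosen hC M.unop).shortExact.comp_extClass_assoc x (add_comm 1 m)

theorem connChosen_naturality (m : ℕ) {M M' : Aᵒᵖ} (f : M ⟶ M') :
    (extFunctor.{v} m).map f ≫ connChosen hC m M' =
      connChosen hC m M ≫ (extFunctor.{v} (m + 1)).map (chosenMap hC f.unop).hom.τ₃.op := by
  refine Eq.trans (congr_arg (fun t : M'.unop ⟶ M.unop =>
    (extFunctor.{v} m).map t.op ≫ connChosen hC m M') (chosenMap_τ₁ hC f.unop).symm) ?_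
  exact (connExt C m).naturality (chosenMap hC f.unop).op

/-- The map `Extᵐ(M, Y) → S⁻¹ Extᵐ⁺¹(M, Y) = Ker (Extᵐ⁺¹(S, Y) → Extᵐ⁺¹(I, Y))` induced by the
connecting map of a special preenvelope. -/
def connSatellite (m : ℕ) : extFunctor.{v} (C := A) m ⟶ satellite hC (extFunctor.{v} (m + 1)) where
  app M := satelliteOnLift (connChosen hC m M) (connChosen_comp hC m M)
  naturality M M' f := by
    change _ = _ ≫ (satelliteOn C (extFunctor.{v} (m + 1))).map (chosenMap hC f.unop).op
    apply (cancel_mono (satelliteOnι _ _)).1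
    simp only [assoc, satelliteOnι_naturality, satelliteOnLift_ι_assoc]
    refine (assoc _ _ _).trans ?_
    rw [satelliteOnLift_ι, connChosen_naturality]

/-- The maps `δ : S⁻ᵏ Extᵐ → S⁻ᵏ⁻¹ Extᵐ⁺¹` induced by the connecting maps. -/
def satelliteδ : ∀ k m : ℕ,
    (iteratedSatellite hC k (extAdd m)).obj ⟶ (iteratedSatellite hC (k + 1) (extAdd (m + 1))).obj
  | 0, m => connSatellite hC m
  | k + 1, m => satelliteMap hC (satelliteδ k m)

end Satellite

/-! ### Special proper coresolutions -/

variable (C) in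
/-- A special proper `C`-coresolution `0 → M → I⁰ → I¹ → ⋯` of the object `M = Z 0`, given by the
short exact sequences `0 → Zⁱ → Iⁱ → Zⁱ⁺¹ → 0` into which it decomposes: all `Iⁱ` are in `C`,
and all `Zⁱ⁺¹` are in `⊥C`. The differential `Iⁱ → Iⁱ⁺¹` is `π i ≫ ι (i + 1)` and
`Zⁱ = Ker (Iⁱ → Iⁱ⁺¹)` is the `i`-th `C`-cosyzygy of `M`. The complex is automatically
`Hom(-, C)`-exact, since `Ext¹(Zⁱ⁺¹, X) = 0` for `X` in `C`. -/
structure Coresolution where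
  Z : ℕ → A
  I : ℕ → A
  ι : ∀ i, Z i ⟶ I i
  π : ∀ i, I i ⟶ Z (i + 1)
  w : ∀ i, ι i ≫ π i = 0
  isSpecial : ∀ i, isSpecialPreenvelope C (ShortComplex.mk (ι i) (π i) (w i))

namespace Coresolution

/-- Morphisms of coresolutions: chain maps of the (augmented) complexes. -/
@[ext]
structure Hom (P Q : Coresolution C) where
  z : ∀ i, P.Z i ⟶ Q.Z i
  f : ∀ i, P.I i ⟶ Q.I i
  comm_ι : ∀ i, P.ι i ≫ f i = z i ≫ Q.ι i
  comm_π : ∀ i, P.π i ≫ z (i + 1) = f i ≫ Q.π i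

instance : Category (Coresolution C) where
  Hom := Hom
  id P := ⟨fun _ => 𝟙 _, fun _ => 𝟙 _, by simp, by simp⟩
  comp φ ψ := ⟨fun i => φ.z i ≫ ψ.z i, fun i => φ.f i ≫ ψ.f i,
    fun i => by rw [← assoc, φ.comm_ι, assoc, ψ.comm_ι, assoc],
    fun i => by rw [← assoc, φ.comm_π, assoc, ψ.comm_π, assoc]⟩
  id_comp _ := by ext <;> exact id_comp _
  comp_id _ := by ext <;> exact comp_id _
  assoc _ _ _ := by ext <;> exact assoc _ _ _

theorem shortExact (P : Coresolution C) (i : ℕ) :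
    (ShortComplex.mk (P.ι i) (P.π i) (P.w i)).ShortExact := (P.isSpecial i).1

variable (C)

/-- The functor sending a coresolution of `M` to its `i`-th cosyzygy `Zⁱ`; in particular
`cosyzygy C 0` is the functor sending a coresolution of `M` to `M`. -/
@[simps]
def cosyzygy (i : ℕ) : Coresolution C ⥤ A where
  obj P := P.Z i
  map φ := φ.z i

/-- The functor sending a coresolution to its `i`-th term `Iⁱ`. -/
@[simps]
def term (i : ℕ) : Coresolution C ⥤ A where
  obj P := P.I i
  map φ := φ.f i

/-- `Zⁱ → Iⁱ` -/
@[simps]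
def incl (i : ℕ) : cosyzygy C i ⟶ term C i where
  app P := P.ι i
  naturality _ _ φ := (φ.comm_ι i).symm

/-- `Iⁱ → Zⁱ⁺¹` -/
@[simps]
def proj (i : ℕ) : term C i ⟶ cosyzygy C (i + 1) where
  app P := P.π i
  naturality _ _ φ := (φ.comm_π i).symm

/-- The functor sending a coresolution to `0 → Zⁱ → Iⁱ → Zⁱ⁺¹ → 0`. -/
def preenvelope (i : ℕ) : Coresolution C ⥤ SpecialPreenvelope C where
  obj P := ⟨ShortComplex.mk (P.ι i) (P.π i) (P.w i), P.isSpecial i⟩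
  map φ := ObjectProperty.homMk
    { τ₁ := φ.z i, τ₂ := φ.f i, τ₃ := φ.z (i + 1)
      comm₁₂ := (φ.comm_ι i).symm, comm₂₃ := (φ.comm_π i).symm }

/-- The functor sending a coresolution of `M` to the coresolution `0 → Zʲ → Iʲ → Iʲ⁺¹ → ⋯` of its
`j`-th cosyzygy. -/
def shift (j : ℕ) : Coresolution C ⥤ Coresolution C where
  obj P :=
    { Z := fun i => P.Z (j + i), I := fun i => P.I (j + i), ι := fun i => P.ι (j + i)
      π := fun i => P.π (j + i), w := fun i => P.w (j + i)
      isSpecial := fun i => P.isSpecial (j + i) }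
  map φ :=
    { z := fun i => φ.z (j + i), f := fun i => φ.f (j + i)
      comm_ι := fun i => φ.comm_ι (j + i)
      comm_π := fun i => φ.comm_π (j + i) }

end Coresolution

open Coresolution SpecialPreenvelope

/-! ### Stable functors -/

section Stable

variable {D : Type u'} [Category.{v'} D] [Abelian D]

variable (C) in
/-- The zeroth left derived functor of a contravariant functor `F` with respect to `C`:
`L₀ F (M) = H⁰(F(I)) = Coker (F(I¹) → F(I⁰))` for a coresolution `I` of `M`. -/
def leftDerivedZero (F : Aᵒᵖ ⥤ D) : (Coresolution C)ᵒᵖ ⥤ D :=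
  cokernel (Functor.whiskerRight (NatTrans.op (proj C 0 ≫ incl C 1)) F)

variable (C) in
/-- The projection `F(I⁰) → L₀ F (M)`. -/
def leftDerivedZeroπ (F : Aᵒᵖ ⥤ D) : (term C 0).op ⋙ F ⟶ leftDerivedZero C F :=
  cokernel.π (Functor.whiskerRight (NatTrans.op (proj C 0 ≫ incl C 1)) F)

instance (F : Aᵒᵖ ⥤ D) : Epi (leftDerivedZeroπ C F) :=
  inferInstanceAs (Epi (cokernel.π _))

variable (C) in
/-- The natural transformation `ρ : L₀ F → F` induced by `F(I⁰) → F(M)`. -/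
def rho (F : Aᵒᵖ ⥤ D) [F.Additive] : leftDerivedZero C F ⟶ (cosyzygy C 0).op ⋙ F :=
  cokernel.desc _ (Functor.whiskerRight (NatTrans.op (incl C 0)) F) (by
    ext P
    change F.map (P.unop.π 0 ≫ P.unop.ι 1).op ≫ F.map (P.unop.ι 0).op = 0
    rw [← F.map_comp, ← op_comp, ← assoc, P.unop.w 0, zero_comp, op_zero, F.map_zero])

variable (C) in
/-- The `C`-stable functor of `F`: the cokernel of `ρ : L₀ F → F`. -/
def stable (F : Aᵒᵖ ⥤ D) [F.Additive] : (Coresolution C)ᵒᵖ ⥤ D := cokernel (rho C F)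

variable (C) in
/-- The projection of `F` onto its stable functor. -/
def stableπ (F : Aᵒᵖ ⥤ D) [F.Additive] : (cosyzygy C 0).op ⋙ F ⟶ stable C F := cokernel.π (rho C F)

instance (F : Aᵒᵖ ⥤ D) [F.Additive] : Epi (stableπ C F) :=
  inferInstanceAs (Epi (cokernel.π (rho C F)))

theorem leftDerivedZeroπ_rho (F : Aᵒᵖ ⥤ D) [F.Additive] :
    leftDerivedZeroπ C F ≫ rho C F = Functor.whiskerRight (NatTrans.op (incl C 0)) F :=
  cokernel.π_desc _ _ _

theorem leftDerivedZeroπ_rho_assoc (F : Aᵒᵖ ⥤ D) [F.Additive] {G : (Coresolution C)ᵒᵖ ⥤ D}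
    (h : (cosyzygy C 0).op ⋙ F ⟶ G) :
    leftDerivedZeroπ C F ≫ rho C F ≫ h = Functor.whiskerRight (NatTrans.op (incl C 0)) F ≫ h := by
  rw [← assoc, leftDerivedZeroπ_rho]

theorem whiskerRight_stableπ (F : Aᵒᵖ ⥤ D) [F.Additive] :
    Functor.whiskerRight (NatTrans.op (incl C 0)) F ≫ stableπ C F = 0 := by
  rw [← leftDerivedZeroπ_rho, assoc, stableπ]
  exact (congr_arg _ (cokernel.condition (rho C F))).trans comp_zero

/-- Morphisms on the stable functor are given by the morphisms on `F` that vanish on the image of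
`F(I⁰) → F(M)`. -/
def stableDesc {F : Aᵒᵖ ⥤ D} [F.Additive] {G : (Coresolution C)ᵒᵖ ⥤ D}
    (α : (cosyzygy C 0).op ⋙ F ⟶ G)
    (h : Functor.whiskerRight (NatTrans.op (incl C 0)) F ≫ α = 0) : stable C F ⟶ G :=
  cokernel.desc (rho C F) α (by
    rw [← cancel_epi (leftDerivedZeroπ C F), leftDerivedZeroπ_rho_assoc, h, comp_zero])

theorem stableπ_desc {F : Aᵒᵖ ⥤ D} [F.Additive] {G : (Coresolution C)ᵒᵖ ⥤ D}
    (α : (cosyzygy C 0).op ⋙ F ⟶ G)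
    (h : Functor.whiskerRight (NatTrans.op (incl C 0)) F ≫ α = 0) :
    stableπ C F ≫ stableDesc α h = α :=
  cokernel.π_desc _ _ _

end Stable

/-- If `p : X → Y` is surjective and `q : X → W` vanishes on its kernel, then `q` factors
through `p`. -/
def groupDesc {X Y W : Type*} [AddCommGroup X] [AddCommGroup Y] [AddCommGroup W]
    (p : X →+ Y) (q : X →+ W) (hp : Function.Surjective p) (hq : ∀ x, p x = 0 → q x = 0) : Y →+ W :=
  p.liftOfSurjective hp ⟨q, fun x hx => hq x hx⟩

theorem groupDesc_apply {X Y W : Type*} [AddCommGroup X] [AddCommGroup Y] [AddCommGroup W]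
    (p : X →+ Y) (q : X →+ W) (hp : Function.Surjective p) (hq : ∀ x, p x = 0 → q x = 0) (x : X) :
    groupDesc p q hp hq (p x) = q x :=
  AddMonoidHom.liftOfRightInverse_comp_apply _ _ _ _ _

/-- If `p : F → G` is surjective and `q : F → H` vanishes on its kernel, then `q` factors
through `p`. -/
def descOfSurjective {J : Type*} [Category* J] {K : Type*} [Category* K]
    {F G H : J ⥤ K ⥤ AddCommGrpCat.{v}} (p : F ⟶ G) (q : F ⟶ H)
    (hp : ∀ j k, Function.Surjective ((p.app j).app k).hom)
    (hq : ∀ j k x, ((p.app j).app k).hom x = 0 → ((q.app j).app k).hom x = 0) : G ⟶ H where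
  app j :=
    { app := fun k => AddCommGrpCat.ofHom
        (groupDesc ((p.app j).app k).hom ((q.app j).app k).hom (hp j k) (hq j k))
      naturality := by
        intro k k' f
        ext x
        obtain ⟨y, rfl⟩ := hp j k x
        have h1 := ConcreteCategory.congr_hom ((p.app j).naturality f) y
        have h2 := ConcreteCategory.congr_hom ((q.app j).naturality f) y
        refine (congr_arg (groupDesc _ _ (hp j k') (hq j k')) h1.symm).trans ?_
        refine (groupDesc_apply _ _ (hp j k') (hq j k') _).trans ?_
        exact h2.trans (congr_arg ((H.obj j).map f).hom (groupDesc_apply _ _ (hp j k) (hq j k) y).symm) }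
  naturality j j' f := by
    ext k x
    obtain ⟨y, rfl⟩ := hp j k x
    have h1 := ConcreteCategory.congr_hom (NatTrans.congr_app (p.naturality f) k) y
    have h2 := ConcreteCategory.congr_hom (NatTrans.congr_app (q.naturality f) k) y
    refine (congr_arg (groupDesc _ _ (hp j' k) (hq j' k)) h1.symm).trans ?_
    refine (groupDesc_apply _ _ (hp j' k) (hq j' k) _).trans ?_
    exact h2.trans (congr_arg ((H.map f).app k).hom (groupDesc_apply _ _ (hp j k) (hq j k) y).symm)

theorem comp_descOfSurjective {J : Type*} [Category* J] {K : Type*} [Category* K]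
    {F G H : J ⥤ K ⥤ AddCommGrpCat.{v}} (p : F ⟶ G) (q : F ⟶ H)
    (hp : ∀ j k, Function.Surjective ((p.app j).app k).hom)
    (hq : ∀ j k x, ((p.app j).app k).hom x = 0 → ((q.app j).app k).hom x = 0) :
    p ≫ descOfSurjective p q hp hq = q := by
  ext j k x
  exact groupDesc_apply _ _ (hp j k) (hq j k) x

/-! ### The bifunctors and the connecting maps -/

section Bifunctors

variable (C)

/-- `(X, N) ↦ Hom(X, Zᵏ N)`. -/
def homTo (k : ℕ) : Aᵒᵖ ⥤ Coresolution C ⥤ AddCommGrpCat.{v} :=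
  homFunctor ⋙ (Functor.whiskeringLeft _ _ _).obj (cosyzygy C k)

/-- `(X, N) ↦ Extᵐ(X, Zᵏ N)`. -/
def extTo (m k : ℕ) : Aᵒᵖ ⥤ Coresolution C ⥤ AddCommGrpCat.{v} :=
  extFunctor.{v} m ⋙ (Functor.whiskeringLeft _ _ _).obj (cosyzygy C k)

instance (k : ℕ) : (homTo C k).Additive := by unfold homTo; infer_instance

instance (m k : ℕ) : (extTo C m k).Additive := by unfold extTo; infer_instance

/-- `(M, N) ↦ StHom(Zʲ M, Zᵏ N)`, the value of the stable functor of `Hom(-, Zᵏ N)` at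
`Zʲ M`. -/
def stableHom (j k : ℕ) : (Coresolution C)ᵒᵖ ⥤ Coresolution C ⥤ AddCommGrpCat.{v} :=
  (shift C j).op ⋙ stable C (homTo C k)

/-- `(M, N) ↦ Ext¹(Zʲ M, Zᵏ N)`. -/
def ext₁ (j k : ℕ) : (Coresolution C)ᵒᵖ ⥤ Coresolution C ⥤ AddCommGrpCat.{v} :=
  (cosyzygy C j).op ⋙ extTo C 1 k

/-- `(M, N) ↦ S⁻¹ Ext¹(Zʲ M, Zᵏ N)`, the value of the left satellite of `Ext¹(-, Zᵏ N)` at `Zʲ M`,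
computed with the special preenvelope `0 → Zʲ M → Iʲ → Zʲ⁺¹ M → 0`. -/
def satelliteExt₁ (j k : ℕ) : (Coresolution C)ᵒᵖ ⥤ Coresolution C ⥤ AddCommGrpCat.{v} :=
  (preenvelope C j).op ⋙ satelliteOn C (extTo C 1 k)

/-- `δ : Hom(Zʲ M, Zᵏ N) → Ext¹(Zʲ⁺¹ M, Zᵏ N)`, the connecting map of
`0 → Zʲ M → Iʲ → Zʲ⁺¹ M → 0`. -/
def homConn (j k : ℕ) : (cosyzygy C j).op ⋙ homTo C k ⟶ ext₁ C (j + 1) k :=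
  Functor.whiskerLeft (preenvelope C j).op (Functor.whiskerRight (connHom C)
    ((Functor.whiskeringLeft _ _ _).obj (cosyzygy C k)))

theorem homConn_app_app (j k : ℕ) (P Q : Coresolution C) (f : P.Z j ⟶ Q.Z k) :
    (((homConn C j k).app (op P)).app Q).hom f =
      (P.shortExact j).extClass.comp (Ext.mk₀ f) (add_zero 1) := rfl

theorem incl_homConn (k : ℕ) :
    Functor.whiskerRight (NatTrans.op (incl C 0)) (homTo C k) ≫ homConn C 0 k = 0 := by
  ext P Q (f : P.unop.I 0 ⟶ Q.Z k)
  change (P.unop.shortExact 0).extClass.comp (Ext.mk₀ (P.unop.ι 0 ≫ f)) (add_zero 1) = 0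
  rw [← Ext.mk₀_comp_mk₀]
  exact (P.unop.shortExact 0).extClass_comp_assoc (Ext.mk₀ f)

/-- The map `δ̄ : StHom(Zʲ M, Zᵏ N) → Ext¹(Zʲ⁺¹ M, Zᵏ N)` induced by `δ`. -/
def deltaBar (j k : ℕ) : stableHom C j k ⟶ ext₁ C (j + 1) k :=
  Functor.whiskerLeft (shift C j).op (stableDesc (homConn C 0 k) (incl_homConn C k))

/-- `∂ : Hom(X, Zᵏ⁺¹ N) → Ext¹(X, Zᵏ N)`, the connecting map of `0 → Zᵏ N → Jᵏ → Zᵏ⁺¹ N → 0`. -/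
def coconn (k : ℕ) : homTo C (k + 1) ⟶ extTo C 1 k :=
  Functor.whiskerRight (coconnHom C) ((Functor.whiskeringLeft _ _ _).obj (preenvelope C k))

/-- `∂ : Hom(Zʲ M, Zᵏ⁺¹ N) → Ext¹(Zʲ M, Zᵏ N)`. -/
def coconnZ (j k : ℕ) : (cosyzygy C j).op ⋙ homTo C (k + 1) ⟶ ext₁ C j k :=
  Functor.whiskerLeft (cosyzygy C j).op (coconn C k)

theorem coconnZ_app_app (j k : ℕ) (P Q : Coresolution C) (g : P.Z j ⟶ Q.Z (k + 1)) :
    (((coconnZ C j k).app (op P)).app Q).hom g =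
      (Ext.mk₀ g).comp (Q.shortExact k).extClass (zero_add 1) := rfl

/-- The projection `Hom(Zʲ M, Zᵏ N) → StHom(Zʲ M, Zᵏ N)`. -/
def stableHomπ (j k : ℕ) : (cosyzygy C j).op ⋙ homTo C k ⟶ stableHom C j k :=
  Functor.whiskerLeft (shift C j).op (stableπ C (homTo C k))

/-- Morphisms that extend along `Zʲ M → Iʲ` vanish in the stable Hom. -/
theorem stableHomπ_eq_zero (j k : ℕ) (P Q : Coresolution C) (f : P.I j ⟶ Q.Z k) :
    (((stableHomπ C j k).app (op P)).app Q).hom (P.ι j ≫ f) = 0 :=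
  congr_arg (fun t => ((t.app (op ((shift C j).obj P))).app Q).hom f)
    (whiskerRight_stableπ (C := C) (homTo C k))

/-- As `Ext¹(Zʲ⁺¹ M, Jᵏ) = 0`, the map `∂ : Hom(Zʲ⁺¹ M, Zᵏ⁺¹ N) → Ext¹(Zʲ⁺¹ M, Zᵏ N)` is
surjective. -/
theorem coconnZ_surjective (j k : ℕ) (P Q : Coresolution C) :
    Function.Surjective (((coconnZ C (j + 1) k).app (op P)).app Q).hom := by
  intro (x : Ext.{v} (P.Z (j + 1)) (Q.Z k) 1)
  have h0 : x.comp (Ext.mk₀ (Q.ι k)) (add_zero 1) = 0 :=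
    @Subsingleton.elim _ ((P.isSpecial j).2.2 _ (Q.isSpecial k).2.1) _ _
  obtain ⟨y, hy⟩ := Ext.covariant_sequence_exact₁ _ (Q.shortExact k) x h0 (zero_add 1)
  obtain ⟨g, hg⟩ : ∃ g : P.Z (j + 1) ⟶ Q.Z (k + 1), Ext.mk₀ g = y :=
    (Ext.mk₀_bijective _ _).2 y
  refine ⟨g, ?_⟩
  rw [coconnZ_app_app, hg]
  exact hy

/-- The projection to the stable Hom vanishes on the kernel of `∂`. -/
theorem stableHomπ_eq_zero_of_coconnZ (j k : ℕ) (P Q : Coresolution C)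
    (g : P.Z (j + 1) ⟶ Q.Z (k + 1))
    (hg : (((coconnZ C (j + 1) k).app (op P)).app Q).hom g = 0) :
    (((stableHomπ C (j + 1) (k + 1)).app (op P)).app Q).hom g = 0 := by
  obtain ⟨y, hy⟩ := Ext.covariant_sequence_exact₃ _ (Q.shortExact k) (Ext.mk₀ g) (zero_add 1) hg
  obtain ⟨h, rfl⟩ : ∃ h : P.Z (j + 1) ⟶ Q.I k, Ext.mk₀ h = y := (Ext.mk₀_bijective _ _).2 y
  obtain ⟨l, hl⟩ : ∃ l : P.I (j + 1) ⟶ Q.I k, P.ι (j + 1) ≫ l = h :=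
    ((preenvelope C (j + 1)).obj P).exists_extension (Q.isSpecial k).2.1 h
  have hg' : g = P.ι (j + 1) ≫ l ≫ Q.π k := by
    apply (Ext.mk₀_bijective _ _).1
    rw [← assoc, hl]
    exact hy.symm.trans (Ext.mk₀_comp_mk₀ h (Q.π k))
  rw [hg']
  exact stableHomπ_eq_zero C (j + 1) (k + 1) P Q (l ≫ Q.π k)

/-- The map `β : Ext¹(Zʲ⁺¹ M, Zᵏ N) → StHom(Zʲ⁺¹ M, Zᵏ⁺¹ N)` with `∂ ≫ β` the projection
`Hom(Zʲ⁺¹ M, Zᵏ⁺¹ N) → StHom(Zʲ⁺¹ M, Zᵏ⁺¹ N)`. -/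
def beta (j k : ℕ) : ext₁ C (j + 1) k ⟶ stableHom C (j + 1) (k + 1) :=
  descOfSurjective (coconnZ C (j + 1) k) (stableHomπ C (j + 1) (k + 1))
    (fun P Q => coconnZ_surjective C j k P.unop Q)
    (fun P Q g hg => stableHomπ_eq_zero_of_coconnZ C j k P.unop Q g hg)

theorem coconnZ_beta (j k : ℕ) :
    coconnZ C (j + 1) k ≫ beta C j k = stableHomπ C (j + 1) (k + 1) :=
  comp_descOfSurjective _ _ _ _

/-- `Δ = β ∘ δ̄ : StHom(Zʲ M, Zᵏ N) → StHom(Zʲ⁺¹ M, Zᵏ⁺¹ N)`. -/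
def Delta (j k : ℕ) : stableHom C j k ⟶ stableHom C (j + 1) (k + 1) :=
  deltaBar C j k ≫ beta C j k

/-- `Ψ = δ̄ ∘ β : Ext¹(Zʲ⁺¹ M, Zᵏ N) → Ext¹(Zʲ⁺² M, Zᵏ⁺¹ N)`. -/
def Psi (j k : ℕ) : ext₁ C (j + 1) k ⟶ ext₁ C (j + 2) (k + 1) :=
  beta C j k ≫ deltaBar C (j + 1) (k + 1)

theorem stableHomπ_deltaBar (j k : ℕ) :
    stableHomπ C j k ≫ deltaBar C j k = homConn C j k := by
  have h := stableπ_desc (C := C) (homConn C 0 k) (incl_homConn C k)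
  exact congr_arg (Functor.whiskerLeft (shift C j).op) h

/-- `Ψ` followed by the map induced by `Iʲ⁺¹ → Zʲ⁺²` is zero. -/
theorem Psi_comp (j k : ℕ) (P : (Coresolution C)ᵒᵖ) :
    (Psi C j k).app P ≫ (extTo C 1 (k + 1)).map (P.unop.π (j + 1)).op = 0 := by
  ext Q x
  obtain ⟨g, rfl⟩ := coconnZ_surjective C j k P.unop Q x
  have h : coconnZ C (j + 1) k ≫ Psi C j k = homConn C (j + 1) (k + 1) := by
    rw [Psi, ← assoc, coconnZ_beta, stableHomπ_deltaBar]
  have h' := ConcreteCategory.congr_hom (NatTrans.congr_app (NatTrans.congr_app h P) Q) g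
  refine (congr_arg (fun t => (((extTo C 1 (k + 1)).map (P.unop.π (j + 1)).op).app Q).hom t)
    h').trans ?_
  exact (P.unop.shortExact (j + 1)).comp_extClass_assoc
    (Ext.mk₀ (show P.unop.Z (j + 1) ⟶ Q.Z (k + 1) from g)) (add_zero 1)

/-- The inclusion `ι : S⁻¹ Ext¹(Zʲ M, Zᵏ N) → Ext¹(Zʲ⁺¹ M, Zᵏ N)`. -/
def iota (j k : ℕ) : satelliteExt₁ C j k ⟶ ext₁ C (j + 1) k where
  app P := satelliteOnι (extTo C 1 k) ((preenvelope C j).obj P.unop)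
  naturality _ _ φ := satelliteOnι_naturality (extTo C 1 k) ((preenvelope C j).map φ.unop)

/-- The map `μ : Ext¹(Zʲ⁺¹ M, Zᵏ N) → S⁻¹ Ext¹(Zʲ⁺¹ M, Zᵏ⁺¹ N)` with `ι ∘ μ = Ψ`. -/
def mu (j k : ℕ) : ext₁ C (j + 1) k ⟶ satelliteExt₁ C (j + 1) (k + 1) where
  app P := satelliteOnLift (E := (preenvelope C (j + 1)).obj P.unop) ((Psi C j k).app P)
    (Psi_comp C j k P)
  naturality P P' φ := by
    apply (cancel_mono (satelliteOnι (extTo C 1 (k + 1)) ((preenvelope C (j + 1)).obj P'.unop))).1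
    refine (assoc _ _ _).trans ?_
    refine (congr_arg _ (satelliteOnLift_ι _ _)).trans ?_
    refine ((Psi C j k).naturality φ).trans ?_
    refine Eq.trans ?_ (assoc _ _ _).symm
    refine Eq.trans ?_ (congr_arg _ (satelliteOnι_naturality (extTo C 1 (k + 1))
      ((preenvelope C (j + 1)).map φ.unop)).symm)
    exact (satelliteOnLift_ι_assoc (F := extTo C 1 (k + 1))
      (E := (preenvelope C (j + 1)).obj P.unop) (X := (ext₁ C (j + 1) k).obj P)
      ((Psi C j k).app P) (Psi_comp C j k P) _).symm

theorem mu_iota (j k : ℕ) : mu C j k ≫ iota C (j + 1) (k + 1) = Psi C j k := by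
  ext1
  ext1 P
  exact satelliteOnLift_ι _ _

/-- `Φ = μ ∘ ι : S⁻¹ Ext¹(Zʲ M, Zᵏ N) → S⁻¹ Ext¹(Zʲ⁺¹ M, Zᵏ⁺¹ N)`. -/
def Phi (j k : ℕ) : satelliteExt₁ C j k ⟶ satelliteExt₁ C (j + 1) (k + 1) :=
  iota C j k ≫ mu C j k

/-! ### The colimits

For `n : ℤ` let `p = max (-n) 0` and `q = max n 0`, so that `q - p = n`. A colimit over all `i` with
`i ≥ 0` and `i + n ≥ 0` is written as the colimit over `l : ℕ`, where `i = p + l` and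
`i + n = q + l`. -/

/-- The complete cohomology `Extⁿ_C(M, N) = colim_i StHom(Zⁱ M, Zⁱ⁺ⁿ N)`. -/
def completeCohomology (n : ℤ) : (Coresolution C)ᵒᵖ ⥤ Coresolution C ⥤ AddCommGrpCat.{v} :=
  colimit (Functor.ofSequence (X := fun l => stableHom C ((-n).toNat + l) (n.toNat + l))
    fun l => Delta C ((-n).toNat + l) (n.toNat + l))

/-- `colim_i Ext¹(Zⁱ⁺¹ M, Zⁱ⁺ⁿ N)`. -/
def colimExt (n : ℤ) : (Coresolution C)ᵒᵖ ⥤ Coresolution C ⥤ AddCommGrpCat.{v} :=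
  colimit (Functor.ofSequence (X := fun l => ext₁ C ((-n).toNat + l + 1) (n.toNat + l))
    fun l => Psi C ((-n).toNat + l) (n.toNat + l))

/-- `colim_i S⁻¹ Ext¹(Zⁱ M, Zⁱ⁺ⁿ N)`. -/
def colimSatelliteExt (n : ℤ) : (Coresolution C)ᵒᵖ ⥤ Coresolution C ⥤ AddCommGrpCat.{v} :=
  colimit (Functor.ofSequence (X := fun l => satelliteExt₁ C ((-n).toNat + l) (n.toNat + l))
    fun l => Phi C ((-n).toNat + l) (n.toNat + l))

variable {C}

/-- `colim_i S⁻ⁱ Extⁿ⁺ⁱ(M, N)`, with the connecting maps `δ` as transition maps. -/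
def colimIteratedSatellite (hC : IsSpecialPreenveloping C) (n : ℤ) :
    Aᵒᵖ ⥤ A ⥤ AddCommGrpCat.{v} :=
  colimit (Functor.ofSequence
    (X := fun l => (iteratedSatellite hC ((-n).toNat + l) (extAdd (n.toNat + l))).obj)
    fun l => satelliteδ hC ((-n).toNat + l) (n.toNat + l))

/-! ### Coresolutions exist and are unique up to homotopy

Every object has a coresolution, every morphism lifts to coresolutions, and the maps that two lifts
of a morphism induce on complete cohomology are equal. So complete cohomology is a bifunctor
of objects. -/

theorem exists_coresolution (hC : IsSpecialPreenveloping C) (M : A) :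
    ∃ P : Coresolution C, P.Z 0 = M := by
  let S : ℕ → A := fun i => Nat.rec M (fun _ X => (chosen hC X).obj.X₃) i
  exact ⟨{ Z := S
           I := fun i => (chosen hC (S i)).obj.X₂
           ι := fun i => (chosen hC (S i)).obj.f
           π := fun i => (chosen hC (S i)).obj.g
           w := fun i => (chosen hC (S i)).obj.zero
           isSpecial := fun i => (chosen hC (S i)).property }, rfl⟩

theorem exists_coresolution_lift (P Q : Coresolution C) (f : P.Z 0 ⟶ Q.Z 0) :
    ∃ φ : P ⟶ Q, φ.z 0 = f := by
  have h : ∀ (i : ℕ) (a : P.Z i ⟶ Q.Z i), ∃ (b : P.I i ⟶ Q.I i) (c : P.Z (i + 1) ⟶ Q.Z (i + 1)),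
      P.ι i ≫ b = a ≫ Q.ι i ∧ P.π i ≫ c = b ≫ Q.π i := by
    intro i a
    obtain ⟨φ, rfl⟩ := SpecialPreenvelope.exists_lift ((preenvelope C i).obj P)
      ((preenvelope C i).obj Q) a
    exact ⟨φ.hom.τ₂, φ.hom.τ₃, φ.hom.comm₁₂.symm, φ.hom.comm₂₃.symm⟩
  choose b c hb hc using h
  let z : ∀ i, P.Z i ⟶ Q.Z i := fun i => Nat.rec f (fun i a => c i a) i
  exact ⟨⟨z, fun i => b i (z i), fun i => hb i (z i), fun i => hc i (z i)⟩, rfl⟩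

theorem exists_sub_eq {P Q : Coresolution C} (φ ψ : P ⟶ Q) (h : φ.z 0 = ψ.z 0) (i : ℕ) :
    ∃ l : P.I i ⟶ Q.Z i, φ.z i - ψ.z i = P.ι i ≫ l := by
  induction i with
  | zero => exact ⟨0, by rw [h, sub_self, comp_zero]⟩
  | succ i ih =>
    obtain ⟨l, hl⟩ := ih
    have := (P.shortExact i).epi_g
    have hz : P.ι i ≫ (φ.f i - ψ.f i - l ≫ Q.ι i) = 0 := by
      rw [Preadditive.comp_sub, Preadditive.comp_sub, φ.comm_ι, ψ.comm_ι, ← assoc, ← hl,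
        Preadditive.sub_comp, sub_self]
    obtain ⟨m, hm⟩ : ∃ m : P.Z (i + 1) ⟶ Q.I i, P.π i ≫ m = φ.f i - ψ.f i - l ≫ Q.ι i :=
      ⟨(P.shortExact i).exact.desc _ hz, (P.shortExact i).exact.g_desc _ hz⟩
    obtain ⟨m', hm'⟩ : ∃ m' : P.I (i + 1) ⟶ Q.I i, P.ι (i + 1) ≫ m' = m :=
      ((preenvelope C (i + 1)).obj P).exists_extension (Q.isSpecial i).2.1 m
    refine ⟨m' ≫ Q.π i, ?_⟩
    have hepi : Epi (P.π i) := this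
    rw [← cancel_epi (P.π i), ← assoc (P.ι (i + 1)), hm', ← assoc, hm, Preadditive.comp_sub,
      φ.comm_π, ψ.comm_π, Preadditive.sub_comp, Preadditive.sub_comp, assoc, Q.w, comp_zero,
      sub_zero]

theorem stableHomπ_surjective (j k : ℕ) (P Q : Coresolution C) :
    Function.Surjective (((stableHomπ C j k).app (op P)).app Q).hom := by
  have h : Epi (((stableπ C (homTo C k)).app (op ((shift C j).obj P))).app Q) := inferInstance
  exact (AddCommGrpCat.epi_iff_surjective _).1 h

/-- The class of a morphism `Zʲ M → Zᵏ N` in the stable Hom. -/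
def stableClass (j k : ℕ) (P Q : Coresolution C) :
    (P.Z j ⟶ Q.Z k) →+ ((stableHom C j k).obj (op P)).obj Q :=
  (((stableHomπ C j k).app (op P)).app Q).hom

theorem stableClass_eq_zero (j k : ℕ) {P Q : Coresolution C} (f : P.I j ⟶ Q.Z k) :
    stableClass j k P Q (P.ι j ≫ f) = 0 :=
  stableHomπ_eq_zero C j k P Q f

theorem stableClass_map (j k : ℕ) {P P' Q Q' : Coresolution C} (α : P' ⟶ P) (β : Q ⟶ Q')
    (g : P.Z j ⟶ Q.Z k) :
    (((stableHom C j k).map α.op).app Q ≫ ((stableHom C j k).obj (op P')).map β).hom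
      (stableClass j k P Q g) = stableClass j k P' Q' ((α.z j ≫ g) ≫ β.z k) := by
  have h1 := ConcreteCategory.congr_hom
    (NatTrans.congr_app ((stableHomπ C j k).naturality α.op) Q) g
  have h2 := DFunLike.congr_fun
    (congr_arg AddCommGrpCat.Hom.hom (((stableHomπ C j k).app (op P')).naturality β)) (α.z j ≫ g)
  exact (congr_arg (((stableHom C j k).obj (op P')).map β).hom h1.symm).trans h2.symm

theorem stableHom_map_app_eq (j k : ℕ) {P P' Q Q' : Coresolution C} (φ φ' : P' ⟶ P)
    (h : φ.z 0 = φ'.z 0) (ψ ψ' : Q ⟶ Q') (h' : ψ.z 0 = ψ'.z 0) :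
    ((stableHom C j k).map φ.op).app Q ≫ ((stableHom C j k).obj (op P')).map ψ =
      ((stableHom C j k).map φ'.op).app Q ≫ ((stableHom C j k).obj (op P')).map ψ' := by
  ext x
  obtain ⟨g, rfl⟩ : ∃ g : P.Z j ⟶ Q.Z k, stableClass j k P Q g = x :=
    stableHomπ_surjective j k P Q x
  obtain ⟨l, hl⟩ := exists_sub_eq φ φ' h j
  obtain ⟨m, hm⟩ := exists_sub_eq ψ ψ' h' k
  obtain ⟨e, he⟩ : ∃ e : P'.I j ⟶ Q.I k, P'.ι j ≫ e = (φ'.z j ≫ g) ≫ Q.ι k :=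
    ((preenvelope C j).obj P').exists_extension (Q.isSpecial k).2.1 _
  have hsub : (φ.z j ≫ g) ≫ ψ.z k = (φ'.z j ≫ g) ≫ ψ'.z k +
      P'.ι j ≫ ((l ≫ g) ≫ ψ.z k + e ≫ m) := by
    rw [Preadditive.comp_add, ← assoc (P'.ι j) e, he, assoc _ (Q.ι k), ← hm,
      ← assoc (P'.ι j), ← assoc (P'.ι j), ← hl]
    simp only [Preadditive.sub_comp, Preadditive.comp_sub, assoc]
    abel
  refine (stableClass_map j k φ ψ g).trans (Eq.trans ?_ (stableClass_map j k φ' ψ' g).symm)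
  rw [hsub, map_add, stableClass_eq_zero, add_zero]

/-- The map on complete cohomology depends only on the underlying morphisms of objects. -/
theorem completeCohomology_map_app_eq (n : ℤ) {P P' Q Q' : Coresolution C} (φ φ' : P' ⟶ P)
    (h : φ.z 0 = φ'.z 0) (ψ ψ' : Q ⟶ Q') (h' : ψ.z 0 = ψ'.z 0) :
    ((completeCohomology C n).map φ.op).app Q ≫ ((completeCohomology C n).obj (op P')).map ψ =
      ((completeCohomology C n).map φ'.op).app Q ≫
        ((completeCohomology C n).obj (op P')).map ψ' := by
  let F := Functor.ofSequence (X := fun l => stableHom C ((-n).toNat + l) (n.toNat + l))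
    fun l => Delta C ((-n).toNat + l) (n.toNat + l)
  let ev := (evaluation (Coresolution C)ᵒᵖ (Coresolution C ⥤ AddCommGrpCat.{v})).obj (op P) ⋙
    (evaluation (Coresolution C) AddCommGrpCat.{v}).obj Q
  refine (isColimitOfPreserves ev (colimit.isColimit F)).hom_ext fun l => ?_
  have key : ∀ (α : P' ⟶ P) (β : Q ⟶ Q'),
      ((colimit.ι F l).app (op P)).app Q ≫ (((completeCohomology C n).map α.op).app Q ≫
        ((completeCohomology C n).obj (op P')).map β) =
      (((F.obj l).map α.op).app Q ≫ ((F.obj l).obj (op P')).map β) ≫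
        ((colimit.ι F l).app (op P')).app Q' := by
    intro α β
    have h1 := NatTrans.congr_app ((colimit.ι F l).naturality α.op) Q
    have h2 := ((colimit.ι F l).app (op P')).naturality β
    refine (assoc _ _ _).symm.trans ?_
    refine (congr_arg (fun t => t ≫ ((completeCohomology C n).obj (op P')).map β) h1.symm).trans ?_
    refine (assoc _ _ _).trans ?_
    refine (congr_arg (fun t => ((F.obj l).map α.op).app Q ≫ t) h2.symm).trans ?_
    exact (assoc _ _ _).symm
  refine (key φ ψ).trans (Eq.trans ?_ (key φ' ψ').symm)
  exact congr_arg (fun t => t ≫ ((colimit.ι F l).app (op P')).app Q')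
    (stableHom_map_app_eq _ _ φ φ' h ψ ψ' h')

variable (C)

/-- A bifunctor on objects, as a bifunctor on coresolutions `(P, Q)` of objects `(M, N)`. -/
def onCoresolutions (F : Aᵒᵖ ⥤ A ⥤ AddCommGrpCat.{v}) :
    (Coresolution C)ᵒᵖ ⥤ Coresolution C ⥤ AddCommGrpCat.{v} :=
  (cosyzygy C 0).op ⋙ F ⋙ (Functor.whiskeringLeft _ _ _).obj (cosyzygy C 0)

end Bifunctors

end CComplete

end

noncomputable section

/-! All the comparisons are instances of one principle: if two sequences interleave, that is, if
there are maps `a l : F l ⟶ G l` and `b l : G l ⟶ F (l + 1)` whose composites are the transition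
maps, then their colimits agree (`nonempty_iso_of_interleaving`). The colimits are taken in
categories of bifunctors on coresolutions, so naturality in both variables comes for free.

For the first two isomorphisms the interleaving maps are already there: `deltaBar` and `beta` link
stable Hom with `Ext¹`, and `iota` and `mu` link the satellites with `Ext¹`.

The third isomorphism passes through the colimit of `Extⁿ⁺ⁱ(Zⁱ M, N)`. On one side, `S⁻ᵏ F (M)`
embeds in `F(Zᵏ M)`, and for `k ≥ 1` the image is the kernel of the map to `F(Iᵏ⁻¹)`, because
satellites vanish on `C` (`exists_comp_iteratedInclusion`). A connecting map `Extᵐ(Zᵏ M, N) →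
Extᵐ⁺¹(Zᵏ⁺¹ M, N)` dies in `Extᵐ⁺¹(Iᵏ, N)`, hence factors through `S⁻ᵏ⁻¹ Extᵐ⁺¹(M, N)`; this gives
an interleaving.

On the other side, if `C` is coresolving, then all positive `Ext` groups from `⊥C` to `C` vanish.
Yoneda product with the class of `0 → N → I⁰ → ⋯ → Zᵏ N → 0` is then an isomorphism `Ext¹(Zʲ⁺¹ M, Zᵏ
N) ≅ Extᵏ⁺¹(Zʲ⁺¹ M, N)` (`isIso_dimensionShift`), and it turns `Psi` into the connecting map
(`Psi_dimensionShift`). -/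

namespace CComplete

/-! ### Colimits of interleaved sequences -/

section Interleaving

variable {E : Type*} [Category* E] {F G : ℕ ⥤ E}

/-- Two interleaved sequences have isomorphic colimits. -/
theorem nonempty_iso_of_interleaving {c : Cocone F} {d : Cocone G} (hc : IsColimit c)
    (hd : IsColimit d) (a : ∀ l, F.obj l ⟶ G.obj l) (b : ∀ l, G.obj l ⟶ F.obj (l + 1))
    (hab : ∀ l, a l ≫ b l = F.map (homOfLE (Nat.le_add_right l 1)))
    (hba : ∀ l, b l ≫ a (l + 1) = G.map (homOfLE (Nat.le_add_right l 1))) :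
    Nonempty (c.pt ≅ d.pt) := by
  -- The two triangle identities already force `a` and `b` to commute with the transition maps: here
  -- both sides are `a l ≫ b l ≫ a (l + 1)`, and below both are `b l ≫ a (l + 1) ≫ b (l + 1)`.
  have ha (l : ℕ) : F.map (homOfLE (Nat.le_add_right l 1)) ≫ a (l + 1) =
      a l ≫ G.map (homOfLE (Nat.le_add_right l 1)) := by
    rw [← hab, ← hba, assoc]
  have hb (l : ℕ) : b l ≫ F.map (homOfLE (Nat.le_add_right (l + 1) 1)) =
      G.map (homOfLE (Nat.le_add_right l 1)) ≫ b (l + 1) := by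
    rw [← hab, ← hba, assoc]
  let α : F ⟶ G := NatTrans.ofSequence a ha
  let β : G ⟶ (Functor.const ℕ).obj c.pt :=
    NatTrans.ofSequence (fun l => b l ≫ c.ι.app (l + 1)) (fun l => by
      dsimp
      rw [comp_id, ← assoc, ← hb, assoc, c.w])
  refine ⟨⟨hc.desc ⟨d.pt, α ≫ d.ι⟩, hd.desc ⟨c.pt, β⟩, hc.hom_ext fun l => ?_,
    hd.hom_ext fun l => ?_⟩⟩
  · rw [hc.fac_assoc]
    change (a l ≫ d.ι.app l) ≫ _ = _
    rw [assoc, hd.fac]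
    change a l ≫ b l ≫ c.ι.app (l + 1) = _
    rw [← assoc, hab, c.w, comp_id]
  · rw [hd.fac_assoc]
    change (b l ≫ c.ι.app (l + 1)) ≫ _ = _
    rw [assoc, hc.fac]
    change b l ≫ a (l + 1) ≫ d.ι.app (l + 1) = _
    rw [← assoc, hba, d.w, comp_id]

theorem nonempty_colimit_ofSequence_iso {X Y : ℕ → E} (f : ∀ l, X l ⟶ X (l + 1))
    (g : ∀ l, Y l ⟶ Y (l + 1)) [HasColimit (Functor.ofSequence f)]
    [HasColimit (Functor.ofSequence g)] (a : ∀ l, X l ⟶ Y l) (b : ∀ l, Y l ⟶ X (l + 1))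
    (hab : ∀ l, a l ≫ b l = f l) (hba : ∀ l, b l ≫ a (l + 1) = g l) :
    Nonempty (colimit (Functor.ofSequence f) ≅ colimit (Functor.ofSequence g)) :=
  nonempty_iso_of_interleaving (colimit.isColimit _) (colimit.isColimit _) a b
    (fun l => (hab l).trans (Functor.ofSequence_map_homOfLE_succ f l).symm)
    (fun l => (hba l).trans (Functor.ofSequence_map_homOfLE_succ g l).symm)

end Interleaving

variable {A : Type u} [Category.{v} A] [Abelian A] [HasExt.{v} A] (C : ObjectProperty A)

open Coresolution SpecialPreenvelope

/-! ### The isomorphisms with the colimits of `Ext¹` and of its satellites -/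

theorem nonempty_completeCohomology_iso_colimExt (n : ℤ) :
    Nonempty (completeCohomology C n ≅ colimExt C n) :=
  nonempty_colimit_ofSequence_iso
    (X := fun l => stableHom C ((-n).toNat + l) (n.toNat + l))
    (Y := fun l => ext₁ C ((-n).toNat + l + 1) (n.toNat + l))
    (fun l => Delta C ((-n).toNat + l) (n.toNat + l))
    (fun l => Psi C ((-n).toNat + l) (n.toNat + l))
    (fun l => deltaBar C ((-n).toNat + l) (n.toNat + l))
    (fun l => beta C ((-n).toNat + l) (n.toNat + l)) (fun _ => rfl) (fun _ => rfl)

theorem nonempty_colimSatelliteExt_iso_colimExt (n : ℤ) :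
    Nonempty (colimSatelliteExt C n ≅ colimExt C n) :=
  nonempty_colimit_ofSequence_iso
    (X := fun l => satelliteExt₁ C ((-n).toNat + l) (n.toNat + l))
    (Y := fun l => ext₁ C ((-n).toNat + l + 1) (n.toNat + l))
    (fun l => Phi C ((-n).toNat + l) (n.toNat + l))
    (fun l => Psi C ((-n).toNat + l) (n.toNat + l))
    (fun l => iota C ((-n).toNat + l) (n.toNat + l))
    (fun l => mu C ((-n).toNat + l) (n.toNat + l)) (fun _ => rfl)
    (fun l => mu_iota C ((-n).toNat + l) (n.toNat + l))

/-! ### Iterated satellites as kernels -/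

variable {C}

section IteratedSatellite

variable {D : Type u'} [Category.{v'} D] [Abelian D] (hC : IsSpecialPreenveloping C)

/-- The map from a special preenvelope of `M` to the chosen one that lifts the identity of `M`. -/
def toChosen (E : SpecialPreenvelope C) : E ⟶ chosen hC E.obj.X₁ :=
  (exists_lift E (chosen hC E.obj.X₁) (𝟙 E.obj.X₁)).choose

theorem toChosen_τ₁ (E : SpecialPreenvelope C) : (toChosen hC E).hom.τ₁ = 𝟙 E.obj.X₁ :=
  (exists_lift E (chosen hC E.obj.X₁) (𝟙 E.obj.X₁)).choose_spec

/-- The map from the chosen special preenvelope of `M` to a given one that lifts the identity. -/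
def fromChosen (E : SpecialPreenvelope C) : chosen hC E.obj.X₁ ⟶ E :=
  (exists_lift (chosen hC E.obj.X₁) E (𝟙 E.obj.X₁)).choose

theorem fromChosen_τ₁ (E : SpecialPreenvelope C) : (fromChosen hC E).hom.τ₁ = 𝟙 E.obj.X₁ :=
  (exists_lift (chosen hC E.obj.X₁) E (𝟙 E.obj.X₁)).choose_spec

/-- The map induced on satellites depends only on the component `τ₁`, so an identity between
composites of lifts need only be checked there. -/
theorem satelliteOn_map_comp_eq (F : Aᵒᵖ ⥤ D) [F.Additive] {E₁ E₂ E₃ : SpecialPreenvelope C}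
    (φ : E₁ ⟶ E₂) (ψ : E₂ ⟶ E₃) (χ : E₁ ⟶ E₃) (h : φ.hom.τ₁ ≫ ψ.hom.τ₁ = χ.hom.τ₁) :
    (satelliteOn C F).map ψ.op ≫ (satelliteOn C F).map φ.op = (satelliteOn C F).map χ.op := by
  rw [← Functor.map_comp, ← op_comp]
  exact satelliteOn_map_eq F _ _ h

/-- The satellite can be computed with any special preenvelope. -/
def satelliteIso (F : Aᵒᵖ ⥤ D) [F.Additive] :
    (source C).op ⋙ satellite hC F ≅ satelliteOn C F :=
  NatIso.ofComponents
    (fun E =>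
      -- Lifts of the identity of `M` in the two directions need not be inverse to each other, but
      -- their composites agree with the identity on `M`, hence on satellites.
      { hom := (satelliteOn C F).map (toChosen hC E.unop).op
        inv := (satelliteOn C F).map (fromChosen hC E.unop).op
        hom_inv_id := (satelliteOn_map_comp_eq F (fromChosen hC E.unop) (toChosen hC E.unop) (𝟙 _)
          ((congr_arg₂ (· ≫ ·) (fromChosen_τ₁ hC E.unop) (toChosen_τ₁ hC E.unop)).trans
            (id_comp _))).trans ((satelliteOn C F).map_id _)
        inv_hom_id := (satelliteOn_map_comp_eq F (toChosen hC E.unop) (fromChosen hC E.unop) (𝟙 _)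
          ((congr_arg₂ (· ≫ ·) (toChosen_τ₁ hC E.unop) (fromChosen_τ₁ hC E.unop)).trans
            (id_comp _))).trans ((satelliteOn C F).map_id _) })
    (fun {E E'} φ =>
      (satelliteOn_map_comp_eq F (toChosen hC E'.unop) (chosenMap hC φ.unop.hom.τ₁)
        (φ.unop ≫ toChosen hC E.unop)
        ((congr_arg₂ (· ≫ ·) (toChosen_τ₁ hC E'.unop) (chosenMap_τ₁ hC φ.unop.hom.τ₁)).trans
          ((id_comp _).trans ((comp_id _).symm.trans
            (congr_arg (φ.unop.hom.τ₁ ≫ ·) (toChosen_τ₁ hC E.unop).symm))))).trans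
        ((satelliteOn C F).map_comp (toChosen hC E.unop).op φ))

/-- The inclusion `S⁻¹ F (M) → F(S)` for special preenvelopes `0 → M → I → S → 0`. -/
def satelliteInclusion (F : Aᵒᵖ ⥤ D) [F.Additive] :
    (source C).op ⋙ satellite hC F ⟶ (quotient C).op ⋙ F :=
  (satelliteIso hC F).hom ≫
    { app := fun E => satelliteOnι F E.unop
      naturality := fun _ _ φ => satelliteOnι_naturality F φ.unop }

instance (F : Aᵒᵖ ⥤ D) [F.Additive] (E : (SpecialPreenvelope C)ᵒᵖ) :
    Mono ((satelliteInclusion hC F).app E) :=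
  mono_comp' inferInstance (inferInstanceAs (Mono (satelliteOnι F E.unop)))

/-- This moves the kernel inclusion from `E` to the chosen preenvelope, on which `satellite`,
`satelliteMap` and `connSatellite` are defined. -/
theorem satelliteInclusion_app (F : Aᵒᵖ ⥤ D) [F.Additive] (E : SpecialPreenvelope C) :
    (satelliteInclusion hC F).app (op E) =
      satelliteOnι F (chosen hC E.obj.X₁) ≫ F.map (toChosen hC E).hom.τ₃.op :=
  satelliteOnι_naturality F (toChosen hC E)

theorem exists_comp_satelliteInclusion (F : Aᵒᵖ ⥤ D) [F.Additive] (E : SpecialPreenvelope C)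
    {X : D} (h : X ⟶ F.obj (op E.obj.X₃)) (w : h ≫ F.map E.obj.g.op = 0) :
    ∃ l, l ≫ (satelliteInclusion hC F).app (op E) = h :=
  ⟨satelliteOnLift h w ≫ (satelliteIso hC F).inv.app (op E), by
    refine (assoc _ _ _).trans ?_
    refine (congr_arg _ ((satelliteIso hC F).inv_hom_id_app_assoc (op E) _)).trans ?_
    exact satelliteOnLift_ι h w⟩

/-- Once both inclusions are written through the chosen preenvelope, this is the naturality of `α`
at the map of cokernels given by `toChosen`. -/
theorem satelliteMap_inclusion {F G : Aᵒᵖ ⥤ D} [F.Additive] [G.Additive] (α : F ⟶ G)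
    (E : (SpecialPreenvelope C)ᵒᵖ) :
    (satelliteMap hC α).app ((source C).op.obj E) ≫ (satelliteInclusion hC G).app E =
      (satelliteInclusion hC F).app E ≫ α.app ((quotient C).op.obj E) := by
  refine (congr_arg _ (satelliteInclusion_app hC G E.unop)).trans ?_
  refine Eq.trans ?_ (congr_arg (· ≫ _) (satelliteInclusion_app hC F E.unop).symm)
  refine (satelliteOnLift_ι_assoc (E := chosen hC E.unop.obj.X₁) _ _ _).trans ?_
  refine (assoc _ _ _).trans (Eq.trans ?_ (assoc _ _ _).symm)
  exact congr_arg _ (α.naturality (toChosen hC E.unop).hom.τ₃.op).symm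

/-- The satellite vanishes on `C`. -/
theorem isZero_satellite_obj (F : Aᵒᵖ ⥤ D) [F.Additive] {X : A} (hX : C X) :
    IsZero ((satellite hC F).obj (op X)) := by
  let E := chosen hC X
  -- The preenvelope of an object of `C` splits, since the identity extends along it. The map `1 - r
  -- ≫ f` descends to a section of `E.obj.g`; hence `F` turns `E.obj.g` into a split monomorphism,
  -- whose kernel is zero.
  obtain ⟨r, hr⟩ : ∃ r : E.obj.X₂ ⟶ E.obj.X₁, E.obj.f ≫ r = 𝟙 E.obj.X₁ :=
    E.exists_extension hX (𝟙 X)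
  have := E.shortExact.epi_g
  have hz : E.obj.f ≫ (𝟙 _ - r ≫ E.obj.f) = 0 := by
    rw [Preadditive.comp_sub, ← assoc, hr, comp_id, id_comp, sub_self]
  have hs : E.shortExact.exact.desc _ hz ≫ E.obj.g = 𝟙 _ := by
    rw [← cancel_epi E.obj.g, ShortComplex.Exact.g_desc_assoc, Preadditive.sub_comp, assoc,
      E.obj.zero, comp_zero, sub_zero, id_comp, comp_id]
  have h0 : satelliteOnι F E = 0 := by
    rw [← comp_id (satelliteOnι F E), ← F.map_id, ← op_id, ← hs, op_comp, F.map_comp,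
      satelliteOnι_comp_assoc, zero_comp]
  have hE : IsZero ((satelliteOn C F).obj (op E)) := IsZero.of_mono_eq_zero (satelliteOnι F E) h0
  exact hE

/-- The coresolution `0 → Z¹ → I¹ → I² → ⋯` of the first cosyzygy. -/
def tail : Coresolution C ⥤ Coresolution C where
  obj P :=
    -- With `i + 1` instead of the `1 + i` of `shift C 1`, the `k`-th cosyzygy of the tail is `P.Z
    -- (k + 1)` by definition, which the recursion in `iteratedInclusion` relies on.
    { Z := fun i => P.Z (i + 1), I := fun i => P.I (i + 1), ι := fun i => P.ι (i + 1)
      π := fun i => P.π (i + 1), w := fun i => P.w (i + 1)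
      isSpecial := fun i => P.isSpecial (i + 1) }
  map φ :=
    { z := fun i => φ.z (i + 1), f := fun i => φ.f (i + 1)
      comm_ι := fun i => φ.comm_ι (i + 1)
      comm_π := fun i => φ.comm_π (i + 1) }

/-- The inclusion `S⁻ᵏ F (M) → F(Zᵏ M)`. -/
def iteratedInclusion : ∀ (k : ℕ) (F : Aᵒᵖ ⥤+ D),
    (cosyzygy C 0).op ⋙ (iteratedSatellite hC k F).obj ⟶ (cosyzygy C k).op ⋙ F.obj
  | 0, _ => 𝟙 _
  | k + 1, F =>
    Functor.whiskerLeft (preenvelope C 0).op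
      (satelliteInclusion hC (iteratedSatellite hC k F).obj) ≫
      Functor.whiskerLeft tail.op (iteratedInclusion k F)

theorem mono_iteratedInclusion_app (k : ℕ) (F : Aᵒᵖ ⥤+ D) (P : Coresolution C) :
    Mono ((iteratedInclusion hC k F).app (op P)) := by
  induction k generalizing P with
  | zero => exact inferInstanceAs (Mono (𝟙 _))
  | succ k ih =>
    have := ih (tail.obj P)
    exact mono_comp' (inferInstanceAs (Mono ((satelliteInclusion hC _).app
      (op ((preenvelope C 0).obj P))))) this

/-- `S⁻ᵏ⁻¹ F (M)` is the kernel of `F(Zᵏ⁺¹ M) → F(Iᵏ)`. -/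
theorem exists_comp_iteratedInclusion (k : ℕ) (F : Aᵒᵖ ⥤+ D) (P : Coresolution C)
    {X : D} (h : X ⟶ F.obj.obj (op (P.Z (k + 1)))) (w : h ≫ F.obj.map (P.π k).op = 0) :
    ∃ l, l ≫ (iteratedInclusion hC (k + 1) F).app (op P) = h := by
  induction k generalizing P with
  | zero =>
    obtain ⟨l, hl⟩ := exists_comp_satelliteInclusion hC F.obj ((preenvelope C 0).obj P) h w
    exact ⟨l, (congr_arg (l ≫ ·) (comp_id _)).trans hl⟩
  | succ k ih =>
    -- The induction hypothesis lifts `h` to `S⁻ᵏ⁻¹ F (Z¹)`. The last lift, to the kernel of `S⁻ᵏ⁻¹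
    -- F (Z¹) → S⁻ᵏ⁻¹ F (I⁰)`, meets no condition because this satellite vanishes on `I⁰`. In the
    -- base case `F(I⁰)` may be nonzero, and `w` is the kernel condition itself.
    obtain ⟨l, hl⟩ := ih (tail.obj P) h w
    obtain ⟨m, hm⟩ := exists_comp_satelliteInclusion hC (iteratedSatellite hC (k + 1) F).obj
      ((preenvelope C 0).obj P) l ((isZero_satellite_obj hC _ (P.isSpecial 0).2.1).eq_of_tgt _ _)
    exact ⟨m, (assoc _ _ _).symm.trans ((congr_arg (· ≫ _) hm).trans hl)⟩

end IteratedSatellite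

/-! ### Connecting maps of `Ext` and iterated satellites -/

/-- The connecting map `Extᵐ(Zʲ M, Y) → Extᵐ⁺¹(Zʲ⁺¹ M, Y)`. -/
def extConn (j m : ℕ) : (cosyzygy C j).op ⋙ extFunctor.{v} m ⟶
    (cosyzygy C (j + 1)).op ⋙ extFunctor.{v} (m + 1) :=
  Functor.whiskerLeft (preenvelope C j).op (connExt C m)

theorem extConn_comp (j m : ℕ) (P : Coresolution C) :
    (extConn j m).app (op P) ≫ (extFunctor.{v} (m + 1)).map (P.π j).op = 0 := by
  ext Y (x : Ext.{v} (P.Z j) Y m)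
  exact (P.shortExact j).comp_extClass_assoc x (add_comm 1 m)

variable (hC : IsSpecialPreenveloping C)

/-- Connecting maps are natural in the preenvelope, and `toChosen` is the identity on the source, so
passing through the chosen preenvelope has no effect. -/
theorem connSatellite_inclusion (m : ℕ) (E : SpecialPreenvelope C) :
    (connSatellite hC m).app (op E.obj.X₁) ≫
      (satelliteInclusion hC (extFunctor.{v} (m + 1))).app (op E) =
        (connExt C m).app (op E) := by
  rw [satelliteInclusion_app]
  refine (satelliteOnLift_ι_assoc (E := chosen hC E.obj.X₁) _ _ _).trans ?_
  refine ((connExt C m).naturality (toChosen hC E).op).symm.trans ?_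
  refine (congr_arg (fun t : E.obj.X₁ ⟶ E.obj.X₁ =>
    (extFunctor.{v} m).map t.op ≫ (connExt C m).app (op E)) (toChosen_τ₁ hC E)).trans ?_
  exact (congr_arg (· ≫ _) ((extFunctor.{v} m).map_id _)).trans (id_comp _)

/-- Inside `F(Zᵏ⁺¹ M)`, the satellite transition map is an ordinary connecting map of the
coresolution. The inductive step applies the previous case to the tail, `satelliteδ` being `S⁻¹` of
its predecessor. -/
theorem satelliteδ_inclusion (k m : ℕ) (P : Coresolution C) :
    (satelliteδ hC k m).app (op (P.Z 0)) ≫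
        (iteratedInclusion hC (k + 1) (extAdd (m + 1))).app (op P) =
      (iteratedInclusion hC k (extAdd m)).app (op P) ≫ (extConn k m).app (op P) := by
  induction k generalizing P with
  | zero =>
    refine Eq.trans ?_ (id_comp _).symm
    refine (congr_arg _ (comp_id _)).trans ?_
    exact connSatellite_inclusion hC m ((preenvelope C 0).obj P)
  | succ k ih =>
    refine (assoc _ _ _).symm.trans ?_
    refine (congr_arg (· ≫ _) (satelliteMap_inclusion hC (satelliteδ hC k m)
      (op ((preenvelope C 0).obj P)))).trans ?_
    refine (assoc _ _ _).trans ?_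
    refine (congr_arg _ (ih (tail.obj P))).trans ?_
    exact (assoc _ _ _).symm

/-- The factorization of the connecting map `Extᵐ(Zᵏ M, Y) → Extᵐ⁺¹(Zᵏ⁺¹ M, Y)` through
`S⁻ᵏ⁻¹ Extᵐ⁺¹(M, Y)`. -/
def extToSatellite (k m : ℕ) : (cosyzygy C k).op ⋙ extFunctor.{v} m ⟶
    (cosyzygy C 0).op ⋙ (iteratedSatellite hC (k + 1) (extAdd (m + 1))).obj where
  app P := (exists_comp_iteratedInclusion hC k (extAdd (m + 1)) P.unop _
    (extConn_comp k m P.unop)).choose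
  naturality P P' φ := by
    have key (P : (Coresolution C)ᵒᵖ) :=
      (exists_comp_iteratedInclusion hC k (extAdd (m + 1)) P.unop _
        (extConn_comp k m P.unop)).choose_spec
    -- The factorizations are chosen separately for each coresolution; they are natural because the
    -- inclusion they are composed with is a natural monomorphism.
    have := mono_iteratedInclusion_app hC (k + 1) (extAdd (m + 1)) P'.unop
    rw [← cancel_mono ((iteratedInclusion hC (k + 1) (extAdd (m + 1))).app P')]
    rw [assoc, assoc, NatTrans.naturality]
    refine (congr_arg _ (key P')).trans ?_
    refine ((extConn k m).naturality φ).trans ?_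
    refine (congr_arg (· ≫ _) (key P).symm).trans ?_
    exact assoc _ _ _

theorem extToSatellite_inclusion (k m : ℕ) :
    extToSatellite hC k m ≫ iteratedInclusion hC (k + 1) (extAdd (m + 1)) = extConn k m := by
  ext1
  ext1 P
  exact (exists_comp_iteratedInclusion hC k (extAdd (m + 1)) P.unop _
    (extConn_comp k m P.unop)).choose_spec

/-- This is the second triangle of the interleaving. After composition with the monomorphism into
`Extᵐ⁺¹(Zᵏ⁺¹ M, -)` it becomes `satelliteδ_inclusion`. -/
theorem inclusion_extToSatellite (k m : ℕ) :
    iteratedInclusion hC k (extAdd m) ≫ extToSatellite hC k m =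
      Functor.whiskerLeft (cosyzygy C 0).op (satelliteδ hC k m) := by
  ext1
  ext1 P
  have := mono_iteratedInclusion_app hC (k + 1) (extAdd (m + 1)) P.unop
  rw [← cancel_mono ((iteratedInclusion hC (k + 1) (extAdd (m + 1))).app P)]
  refine Eq.trans ?_ (satelliteδ_inclusion hC k m P.unop).symm
  refine (assoc _ _ _).trans ?_
  exact congr_arg _ (NatTrans.congr_app (extToSatellite_inclusion hC k m) P)

/-! ### Dimension shifting in the second variable -/

/-- If `C` is coresolving, all higher `Ext` groups from `⊥C` to `C` vanish. -/
theorem subsingleton_ext_of_leftPerp [EnoughInjectives A] (h : IsCoresolving C) {X Y : A}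
    (hX : leftPerp C X) (hY : C Y) (m : ℕ) : Subsingleton (Ext.{v} X Y (m + 1)) := by
  induction m generalizing Y with
  | zero => exact hX Y hY
  | succ m ih =>
    -- Embed `Y` in an injective object; the cokernel is again in `C` because `C` is coresolving. As
    -- `Ext` into an injective vanishes in positive degrees, every class in degree `m + 2` comes
    -- from degree `m + 1` of the cokernel.
    let S := ShortComplex.mk _ _ (cokernel.condition (Injective.ι Y))
    have hS : S.ShortExact :=
      { exact := ShortComplex.exact_of_g_is_cokernel _ (cokernelIsCokernel S.f) }
    have h3 : C S.X₃ := (h.mem_iff S hS hY).1 (h.injective_mem _ inferInstance)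
    have := ih h3
    refine subsingleton_of_forall_eq 0 fun x => ?_
    obtain ⟨y, rfl⟩ := Ext.covariant_sequence_exact₁ X hS x (Ext.eq_zero_of_injective _) rfl
    rw [Subsingleton.elim y 0, Ext.zero_comp]

/-- The Yoneda class of `0 → N → I⁰ → ⋯ → Iᵏ⁻¹ → Zᵏ N → 0`. -/
def cosyzygyClass (Q : Coresolution C) : ∀ k : ℕ, Ext.{v} (Q.Z k) (Q.Z 0) k
  | 0 => Ext.mk₀ (𝟙 _)
  | k + 1 => (Q.shortExact k).extClass.comp (cosyzygyClass Q k) (add_comm 1 k)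

/-- Extension classes are natural for morphisms of short exact sequences, and the Yoneda class is
their product. This yields the naturality of `dimensionShift` in `N`. -/
theorem cosyzygyClass_naturality {Q Q' : Coresolution C} (φ : Q ⟶ Q') (k : ℕ) :
    (cosyzygyClass Q k).comp (Ext.mk₀ (φ.z 0)) (add_zero k) =
      (Ext.mk₀ (φ.z k)).comp (cosyzygyClass Q' k) (zero_add k) := by
  induction k with
  | zero => rw [cosyzygyClass, cosyzygyClass, Ext.mk₀_comp_mk₀, Ext.mk₀_comp_mk₀, id_comp, comp_id]
  | succ k ih =>
    have h : (Q.shortExact k).extClass.comp (Ext.mk₀ (φ.z k)) (add_zero 1) =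
        (Ext.mk₀ (φ.z (k + 1))).comp (Q'.shortExact k).extClass (zero_add 1) :=
      ShortComplex.ShortExact.extClass_naturality (Q.shortExact k) (Q'.shortExact k)
        ((preenvelope C k).map φ).hom
    rw [cosyzygyClass, cosyzygyClass, Ext.comp_assoc_of_third_deg_zero, ih,
      ← Ext.comp_assoc_of_second_deg_zero, h]
    exact Ext.comp_assoc _ _ _ (zero_add 1) (add_comm 1 k) (by lia)

/-- The product is a composite of connecting maps of `0 → Zⁱ → Iⁱ → Zⁱ⁺¹ → 0`, each bijective
because the neighbouring groups `Ext(X, Iⁱ)` vanish. Injectivity needs this vanishing already in the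
starting degree, hence the positive degree `m + 1`. The free total degree `m'` lets the induction
raise `m` without transporting classes between equal degrees. -/
theorem comp_cosyzygyClass_bijective [EnoughInjectives A] (h : IsCoresolving C) {X : A}
    (hX : leftPerp C X) (Q : Coresolution C) (k m m' : ℕ) (hm : m + 1 + k = m') :
    Function.Bijective (fun x : Ext.{v} X (Q.Z k) (m + 1) => x.comp (cosyzygyClass Q k) hm) := by
  induction k generalizing m with
  | zero =>
    obtain rfl : m + 1 = m' := hm
    convert Function.bijective_id using 1
    ext x
    exact Ext.comp_mk₀_id x
  | succ k ih =>
    have h1 : Function.Bijective (fun x : Ext.{v} X (Q.Z (k + 1)) (m + 1) =>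
        x.comp (Q.shortExact k).extClass (rfl : m + 1 + 1 = m + 1 + 1)) := by
      have h2 := subsingleton_ext_of_leftPerp h hX (Q.isSpecial k).2.1
      constructor
      · refine (injective_iff_map_eq_zero ((Q.shortExact k).extClass.postcomp X rfl)).2
          fun x hx => ?_
        obtain ⟨y, rfl⟩ := Ext.covariant_sequence_exact₃ X (Q.shortExact k) x rfl hx
        have := h2 m
        rw [Subsingleton.elim y 0, Ext.zero_comp]
      · intro x
        exact Ext.covariant_sequence_exact₁ X (Q.shortExact k) x
          (@Subsingleton.elim _ (h2 (m + 1)) _ _) rfl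
    -- The connecting map `h1` has used up one unit of degree, so the remaining `k` steps start from
    -- `m + 1`.
    have h3 := (ih (m + 1) (by lia)).comp h1
    convert h3 using 1
    ext x
    exact (Ext.comp_assoc x _ _ rfl (add_comm 1 k) (by lia)).symm

variable (C) in
/-- The Yoneda product `Ext¹(Zʲ M, Zᵏ N) → Extᵏ⁺¹(Zʲ M, N)` with the class of
`0 → N → I⁰ → ⋯ → Iᵏ⁻¹ → Zᵏ N → 0`. -/
def dimensionShift (j k : ℕ) : ext₁ C j k ⟶ (cosyzygy C j).op ⋙ extTo C (k + 1) 0 where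
  app P :=
    { app := fun Q => AddCommGrpCat.ofHom
        ((cosyzygyClass Q k).postcomp (P.unop.Z j) (add_comm 1 k))
      naturality := by
        intro Q Q' φ
        ext (x : Ext.{v} (P.unop.Z j) (Q.Z k) 1)
        change (x.comp (Ext.mk₀ (φ.z k)) (add_zero 1)).comp (cosyzygyClass Q' k) (add_comm 1 k) =
          (x.comp (cosyzygyClass Q k) (add_comm 1 k)).comp (Ext.mk₀ (φ.z 0)) (add_zero (k + 1))
        rw [Ext.comp_assoc_of_second_deg_zero, ← cosyzygyClass_naturality,
          Ext.comp_assoc_of_third_deg_zero] }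
  naturality P P' φ := by
    ext Q (x : Ext.{v} (P.unop.Z j) (Q.Z k) 1)
    exact Ext.comp_assoc (Ext.mk₀ (φ.unop.z j)) x (cosyzygyClass Q k) (zero_add 1) (add_comm 1 k)
      (by lia)

/-- The index `j + 1` matters: positive cosyzygies lie in `⊥C`, whereas `Z⁰ = M` is arbitrary. -/
theorem isIso_dimensionShift [EnoughInjectives A] (h : IsCoresolving C) (j k : ℕ) :
    IsIso (dimensionShift C (j + 1) k) := by
  refine @NatIso.isIso_of_isIso_app _ _ _ _ _ _ _ fun P => ?_
  refine @NatIso.isIso_of_isIso_app _ _ _ _ _ _ _ fun Q => ?_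
  refine (ConcreteCategory.isIso_iff_bijective _).2 ?_
  exact comp_cosyzygyClass_bijective h (P.unop.isSpecial j).2.2 Q k 0 (k + 1) (by lia)

variable (C) in
/-- The connecting map `Extᵐ(Zʲ M, N) → Extᵐ⁺¹(Zʲ⁺¹ M, N)` of bifunctors on coresolutions. -/
def extConnOn (j m : ℕ) :
    (cosyzygy C j).op ⋙ extTo C m 0 ⟶ (cosyzygy C (j + 1)).op ⋙ extTo C (m + 1) 0 :=
  Functor.whiskerRight (extConn j m) ((Functor.whiskeringLeft _ _ _).obj (cosyzygy C 0))

/-- Every class in `Ext¹(Zʲ⁺¹ M, Zᵏ N)` has the form `g · e`, with `e` the extension class in the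
coresolution of `N`, and `Psi` sends it to `e' · g`, with `e'` the one for `M`. Both sides are then
the product of `e'`, `g`, `e` and the class of `Zᵏ N`, bracketed differently, so no sign appears. -/
theorem Psi_dimensionShift (j k : ℕ) :
    Psi C j k ≫ dimensionShift C (j + 2) (k + 1) =
      dimensionShift C (j + 1) k ≫ extConnOn C (j + 1) (k + 1) := by
  ext P Q x
  obtain ⟨g, rfl⟩ := coconnZ_surjective C j k P.unop Q x
  have h : coconnZ C (j + 1) k ≫ Psi C j k = homConn C (j + 1) (k + 1) := by
    rw [Psi, ← assoc, coconnZ_beta, stableHomπ_deltaBar]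
  have h' := ConcreteCategory.congr_hom (NatTrans.congr_app (NatTrans.congr_app h P) Q) g
  refine (congr_arg (fun t => (((dimensionShift C (j + 2) (k + 1)).app P).app Q).hom t)
    h').trans ?_
  change ((P.unop.shortExact (j + 1)).extClass.comp (Ext.mk₀ g) (add_zero 1)).comp
      ((Q.shortExact k).extClass.comp (cosyzygyClass Q k) (add_comm 1 k)) (add_comm 1 (k + 1)) =
    (P.unop.shortExact (j + 1)).extClass.comp
      (((Ext.mk₀ g).comp (Q.shortExact k).extClass (zero_add 1)).comp (cosyzygyClass Q k)
        (add_comm 1 k)) (add_comm 1 (k + 1))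
  refine (Ext.comp_assoc_of_second_deg_zero _ _ _ _).trans ?_
  exact congr_arg (fun t => (P.unop.shortExact (j + 1)).extClass.comp t (add_comm 1 (k + 1)))
    (Ext.comp_assoc _ _ _ (zero_add 1) (add_comm 1 k) (by lia)).symm

/-! ### Comparison with the colimit of the iterated satellites -/

theorem nonempty_colimExt_iso_colimExtConn [EnoughInjectives A] (h : IsCoresolving C) (n : ℤ) :
    Nonempty (colimExt C n ≅ colimit (Functor.ofSequence
      (X := fun l => (cosyzygy C ((-n).toNat + l)).op ⋙ extTo C (n.toNat + l) 0)
      fun l => extConnOn C ((-n).toNat + l) (n.toNat + l))) := by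
  have := isIso_dimensionShift h
  obtain ⟨e₁⟩ := nonempty_colimit_ofSequence_iso
    (X := fun l => ext₁ C ((-n).toNat + l + 1) (n.toNat + l))
    (Y := fun l => (cosyzygy C ((-n).toNat + l + 1)).op ⋙ extTo C (n.toNat + l + 1) 0)
    (fun l => Psi C ((-n).toNat + l) (n.toNat + l))
    (fun l => extConnOn C ((-n).toNat + l + 1) (n.toNat + l + 1))
    (fun l => dimensionShift C ((-n).toNat + l + 1) (n.toNat + l))
    (fun l => inv (dimensionShift C ((-n).toNat + l + 1) (n.toNat + l)) ≫
      Psi C ((-n).toNat + l) (n.toNat + l))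
    (fun l => IsIso.hom_inv_id_assoc _ _)
    (fun l => by
      refine (assoc _ _ _).trans ?_
      refine (congr_arg _ (Psi_dimensionShift ((-n).toNat + l) (n.toNat + l))).trans ?_
      exact IsIso.inv_hom_id_assoc _ _)
  -- Dimension shifting reaches only `Zⁱ⁺¹`, that is, the sequence without its first term. Dropping
  -- that term does not change the colimit: a sequence interleaves with its own shift through the
  -- transition maps and identities.
  obtain ⟨e₂⟩ := nonempty_colimit_ofSequence_iso
    (X := fun l => (cosyzygy C ((-n).toNat + l)).op ⋙ extTo C (n.toNat + l) 0)
    (Y := fun l => (cosyzygy C ((-n).toNat + l + 1)).op ⋙ extTo C (n.toNat + l + 1) 0)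
    (fun l => extConnOn C ((-n).toNat + l) (n.toNat + l))
    (fun l => extConnOn C ((-n).toNat + l + 1) (n.toNat + l + 1))
    (fun l => extConnOn C ((-n).toNat + l) (n.toNat + l))
    (fun l => 𝟙 _) (fun l => comp_id _) (fun l => id_comp _)
  exact ⟨e₁ ≪≫ e₂.symm⟩

variable (C) in
/-- Restriction of bifunctors on objects to bifunctors on coresolutions. -/
def onCoresolutionsFunctor : (Aᵒᵖ ⥤ A ⥤ AddCommGrpCat.{v}) ⥤
    ((Coresolution C)ᵒᵖ ⥤ Coresolution C ⥤ AddCommGrpCat.{v}) :=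
  (Functor.whiskeringLeft _ _ _).obj (cosyzygy C 0).op ⋙
    (Functor.whiskeringRight _ _ _).obj ((Functor.whiskeringLeft _ _ _).obj (cosyzygy C 0))

/-- Colimits of functors are computed pointwise, so precomposition in either variable preserves
them. -/
instance : PreservesColimitsOfShape ℕ (onCoresolutionsFunctor C) := by
  unfold onCoresolutionsFunctor
  infer_instance

theorem nonempty_iteratedSatellite_iso_colimExtConn (hC : IsSpecialPreenveloping C) (n : ℤ) :
    Nonempty (onCoresolutions C (colimIteratedSatellite hC n) ≅ colimit (Functor.ofSequence
      (X := fun l => (cosyzygy C ((-n).toNat + l)).op ⋙ extTo C (n.toNat + l) 0)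
      fun l => extConnOn C ((-n).toNat + l) (n.toNat + l))) := by
  let W : (A ⥤ AddCommGrpCat.{v}) ⥤ (Coresolution C ⥤ AddCommGrpCat.{v}) :=
    (Functor.whiskeringLeft _ _ _).obj (cosyzygy C 0)
  let f := fun l => satelliteδ hC ((-n).toNat + l) (n.toNat + l)
  let g := fun l => extConnOn C ((-n).toNat + l) (n.toNat + l)
  -- The satellite colimit is formed over objects and the other one over coresolutions; restriction
  -- to coresolutions preserves the former, so both become colimits of bifunctors on coresolutions.
  refine nonempty_iso_of_interleaving
    (F := Functor.ofSequence (X := fun l => (iteratedSatellite hC ((-n).toNat + l)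
      (extAdd (n.toNat + l))).obj) f ⋙ onCoresolutionsFunctor C)
    (G := Functor.ofSequence
      (X := fun l => (cosyzygy C ((-n).toNat + l)).op ⋙ extTo C (n.toNat + l) 0) g)
    (isColimitOfPreserves (onCoresolutionsFunctor C) (colimit.isColimit _))
    (colimit.isColimit _)
    (fun l => Functor.whiskerRight
      (iteratedInclusion hC ((-n).toNat + l) (extAdd (n.toNat + l))) W)
    (fun l => Functor.whiskerRight (extToSatellite hC ((-n).toNat + l) (n.toNat + l)) W)
    (fun l => ?_) (fun l => ?_)
  · refine Eq.trans ?_ (congr_arg (onCoresolutionsFunctor C).map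
      (Functor.ofSequence_map_homOfLE_succ f l).symm)
    refine (Functor.whiskerRight_comp _ _ _).symm.trans ?_
    exact congr_arg (fun t => Functor.whiskerRight t W)
      (inclusion_extToSatellite hC ((-n).toNat + l) (n.toNat + l))
  · refine Eq.trans ?_ (Functor.ofSequence_map_homOfLE_succ g l).symm
    refine (Functor.whiskerRight_comp _ _ _).symm.trans ?_
    exact congr_arg (fun t => Functor.whiskerRight t W)
      (extToSatellite_inclusion hC ((-n).toNat + l) (n.toNat + l))

end CComplete

end

theorem theorem3p4 {A : Type u} [Category.{v} A] [Abelian A] [IsGrothendieckAbelian.{v} A]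
    (C : ObjectProperty A) [C.IsClosedUnderFiniteProducts] [C.IsStableUnderRetracts]
    (hC : CComplete.IsSpecialPreenveloping C) (n : ℤ) :
    Nonempty (CComplete.completeCohomology C n ≅ CComplete.colimExt C n) ∧
    Nonempty (CComplete.completeCohomology C n ≅ CComplete.colimSatelliteExt C n) ∧
    (CComplete.IsCoresolving C →
      Nonempty (CComplete.completeCohomology C n ≅
        CComplete.onCoresolutions C (CComplete.colimIteratedSatellite hC n))) := by
  obtain ⟨e₁⟩ := CComplete.nonempty_completeCohomology_iso_colimExt C n
  obtain ⟨e₂⟩ := CComplete.nonempty_colimSatelliteExt_iso_colimExt C n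
  refine ⟨⟨e₁⟩, ⟨e₁ ≪≫ e₂.symm⟩, fun h => ?_⟩
  -- The enough injectives used for dimension shifting come from `A` being a Grothendieck category.
  obtain ⟨e₃⟩ := CComplete.nonempty_colimExt_iso_colimExtConn h n
  obtain ⟨e₄⟩ := CComplete.nonempty_iteratedSatellite_iso_colimExtConn hC n
  exact ⟨e₁ ≪≫ e₃ ≪≫ e₄.symm⟩
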